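/- A PC prograph of size $n\ge 1$ is a connected oriented plane graph without oriented cycles whose vertices are $n$ coproducts (one input below, a left and a right output above) and $n$ products (a left and a right input below, one output above), in which every output is joined by an edge to one input, except that the input of exactly one coproduct and the output of exactly one product are left free; the free input and the free output lie on the outer face, and prographs are considered up to orientation-preserving isomorphism of plane graphs respecting this structure. The two classical rotations are: (a) for coproducts, if the right output of a coproduct $x$ is joined to the input of a coproduct $y$, replace $(a,(b,c))$ by $((a,b),c)$, where $a$, $b$, $c$ are, from left to right, the three upper edges of the pair $x,y$; (b) for products, if the output of a product $y$ is joined to the left input of a product $x$, replace $((a,b),c)$ by $(a,(b,c))$, where $a$, $b$, $c$ are, from left to right, the three lower edges of the pair. All other edges are unchanged. Let $n\ge 1$, and let $\mathcal A_n$ be the set of PC prographs of size $n$ with no edge from the output of a product to the input of a coproduct. Let $\mathcal T_n$ be the Tamari lattice, i.e. the set of binary trees with $n$ nodes, where $S\le T$ if $T$ is obtained from $S$ by a sequence of right rotations $((a,b),c)\mapsto(a,(b,c))$. 1. A PC prograph of size $n$ belongs to $\mathcal A_n$ if and only if it is the gluing of a tree $S$ formed by its $n$ coproducts with a tree $T$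 formed by its $n$ products, that is, the $k$-th leaf of $S$, from left to right, is joined to the $k$-th leaf of $T$ for $k=1,\dots,n+1$, the free input being the root of $S$ and the free output the root of $T$. 2. $\mathcal T_n$ is a lattice, and $\mathcal A_n$, ordered by $Q\le R$ if $R$ is obtained from $Q$ by a sequence of rotations (a) and (b), is a lattice. There is an isomorphism of lattices $\mathcal A_n\cong\mathcal T_n\times\mathcal T_n$, which sends the gluing of $S$ with $T$ to $(\overline S,T)$, where $\overline S$ is the mirror image of $S$ (the tree of coproducts turned by half a turn, so that it hangs from its root like a tree of products). -/

import Mathlib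

/-! ### Product-coproduct prographs as plane graphs

The objects are plane graphs, encoded as combinatorial maps: every vertex carries named half-edges
(ports), the edges match the ports, and the cyclic order of the ports around a vertex determines
the faces.  `C` and `P` are the (finite) types of coproducts and of products. -/

/-- The outputs of the operators: each coproduct has a left and a right output, each product has
one output. -/
inductive OutPort (C P : Type) : Type where
  | copL (c : C) : OutPort C P
  | copR (c : C) : OutPort C P
  | prod (p : P) : OutPort C P

/-- The inputs of the operators: each coproduct has one input, each product has a left and a
right input. -/
inductive InPort (C P : Type) : Type where
  | cop (c : C) : InPort C P
  | prodL (p : P) : InPort C P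
  | prodR (p : P) : InPort C P

/-- The operator that owns an output. -/
def OutPort.vertex {C P : Type} : OutPort C P → C ⊕ P
  | .copL c => Sum.inl c
  | .copR c => Sum.inl c
  | .prod p => Sum.inr p

/-- The operator that owns an input. -/
def InPort.vertex {C P : Type} : InPort C P → C ⊕ P
  | .cop c => Sum.inl c
  | .prodL p => Sum.inr p
  | .prodR p => Sum.inr p

/-- Renaming the operators that own the outputs. -/
def OutPort.map {C P C' P' : Type} (f : C → C') (g : P → P') : OutPort C P → OutPort C' P'
  | .copL c => .copL (f c)
  | .copR c => .copR (f c)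
  | .prod p => .prod (g p)

/-- Renaming the operators that own the inputs. -/
def InPort.map {C P C' P' : Type} (f : C → C') (g : P → P') : InPort C P → InPort C' P'
  | .cop c => .cop (f c)
  | .prodL p => .prodL (g p)
  | .prodR p => .prodR (g p)

/-- A half-edge. -/
abbrev Dart (C P : Type) : Type := OutPort C P ⊕ InPort C P

/-- The counterclockwise rotation of the half-edges around each vertex, where inputs are drawn
below the vertex and outputs above it: `(input, right output, left output)` around a coproduct and
`(left input, right input, output)` around a product. -/
def dartRotation (C P : Type) : Equiv.Perm (Dart C P) where
  toFun
    | .inr (.cop c) => .inl (.copR c)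
    | .inl (.copR c) => .inl (.copL c)
    | .inl (.copL c) => .inr (.cop c)
    | .inr (.prodL p) => .inr (.prodR p)
    | .inr (.prodR p) => .inl (.prod p)
    | .inl (.prod p) => .inr (.prodL p)
  invFun
    | .inl (.copR c) => .inr (.cop c)
    | .inl (.copL c) => .inl (.copR c)
    | .inr (.cop c) => .inl (.copL c)
    | .inr (.prodR p) => .inr (.prodL p)
    | .inl (.prod p) => .inr (.prodR p)
    | .inr (.prodL p) => .inl (.prod p)
  left_inv := by rintro ((c | c | p) | (c | p | p)) <;> rfl
  right_inv := by rintro ((c | c | p) | (c | p | p)) <;> rfl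

/-- The involution that exchanges the two half-edges of each edge. -/
def edgeFlip {C P : Type} (w : OutPort C P ≃ InPort C P) : Equiv.Perm (Dart C P) where
  toFun
    | .inl o => .inr (w o)
    | .inr i => .inl (w.symm i)
  invFun
    | .inl o => .inr (w o)
    | .inr i => .inl (w.symm i)
  left_inv := by rintro (o | i) <;> simp
  right_inv := by rintro (o | i) <;> simp

/-- The faces of the embedded graph: the orbits of "cross the edge, then turn at the vertex". -/
def Faces {C P : Type} (w : OutPort C P ≃ InPort C P) : Type :=
  Quotient (Equiv.Perm.SameCycle.setoid ((edgeFlip w).trans (dartRotation C P)))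

/-- There is an edge from operator `x` to operator `y`, other than the edge that leaves the output
of the product `north`. -/
def EdgeRel {C P : Type} (w : OutPort C P ≃ InPort C P) (north : P) (x y : C ⊕ P) : Prop :=
  ∃ o : OutPort C P, o ≠ .prod north ∧ o.vertex = x ∧ (w o).vertex = y

/-- A PC prograph with set of coproducts `C` and set of products `P`.

Each output is joined to one input, except that the output of one product `north` and the input of
one coproduct `south` are left unconnected.  In the prograph drawn on the sphere, these two are
joined by an additional *closing edge*, which runs outside of the drawing; `wire` records all the
edges on the sphere, the closing edge included.  The prograph itself (without the closing edge) is
connected and has no oriented cycle, and the graph on the sphere is planar (Euler's formula), so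
that the free input and the free output lie on a common face of the prograph. -/
structure LabelledPrograph (C P : Type) : Type where
  wire : OutPort C P ≃ InPort C P
  north : P
  south : C
  closing : wire (.prod north) = .cop south
  connected : (SimpleGraph.fromRel (EdgeRel wire north)).Connected
  acyclic : ∀ x : C ⊕ P, ¬ Relation.TransGen (EdgeRel wire north) x x
  planar : Nat.card (C ⊕ P) + Nat.card (Faces wire) = Nat.card (OutPort C P) + 2

namespace LabelledPrograph

variable {C P : Type}

/-- Two prographs that differ by the names of their operators. -/
def Iso {C' P' : Type} (G : LabelledPrograph C P) (H : LabelledPrograph C' P') : Prop :=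
  ∃ (f : C ≃ C') (g : P ≃ P'), g G.north = H.north ∧
    ∀ o : OutPort C P, H.wire (o.map f g) = (G.wire o).map f g

/-- Some edge of the prograph goes from the output of a product to the input of a coproduct. -/
def HasProdCopEdge (G : LabelledPrograph C P) : Prop :=
  ∃ (p : P) (c : C), p ≠ G.north ∧ G.wire (.prod p) = .cop c

/-- The rotation of coproducts: the right output of the coproduct `x` enters the coproduct `y`;
afterwards the left output of `x` enters `y`.  The three upper edges keep their order from
left to right, and all the other edges are unchanged. -/
def CopRotation (G H : LabelledPrograph C P) : Prop :=
  H.north = G.north ∧ ∃ x y : C, G.wire (.copR x) = .cop y ∧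
    H.wire (.copL x) = .cop y ∧
    H.wire (.copL y) = G.wire (.copL x) ∧
    H.wire (.copR y) = G.wire (.copL y) ∧
    H.wire (.copR x) = G.wire (.copR y) ∧
    (∀ z : C, z ≠ x → z ≠ y →
      H.wire (.copL z) = G.wire (.copL z) ∧ H.wire (.copR z) = G.wire (.copR z)) ∧
    ∀ p : P, H.wire (.prod p) = G.wire (.prod p)

/-- The rotation of products: the left input of the product `x` comes from the product `y`;
afterwards the right input of `x` comes from `y`.  The three lower edges keep their order from
left to right, and all the other edges are unchanged. -/
def ProdRotation (G H : LabelledPrograph C P) : Prop :=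
  H.north = G.north ∧ ∃ x y : P, G.wire.symm (.prodL x) = .prod y ∧
    H.wire.symm (.prodR x) = .prod y ∧
    H.wire.symm (.prodL x) = G.wire.symm (.prodL y) ∧
    H.wire.symm (.prodL y) = G.wire.symm (.prodR y) ∧
    H.wire.symm (.prodR y) = G.wire.symm (.prodR x) ∧
    (∀ z : P, z ≠ x → z ≠ y →
      H.wire.symm (.prodL z) = G.wire.symm (.prodL z) ∧
      H.wire.symm (.prodR z) = G.wire.symm (.prodR z)) ∧
    ∀ c : C, H.wire.symm (.cop c) = G.wire.symm (.cop c)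

/-- `CopTree G e t L`: following the edge `e` upwards through coproducts one reads the
binary tree `t`, whose leaves are, from left to right, the edges in the list `L`, which do not
enter a coproduct.  An edge is named by the output it starts from. -/
inductive CopTree (G : LabelledPrograph C P) :
    OutPort C P → BinaryTree Unit → List (OutPort C P) → Prop where
  | leaf (e : OutPort C P) (he : ∀ c : C, G.wire e ≠ .cop c) : CopTree G e .nil [e]
  | node (e : OutPort C P) (c : C) (he : G.wire e = .cop c) (s t : BinaryTree Unit)
      (K L : List (OutPort C P)) (hs : CopTree G (.copL c) s K) (ht : CopTree G (.copR c) t L) :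
      CopTree G e (.node () s t) (K ++ L)

/-- `ProdTree G e t L`: following the edge `e` downwards through products one reads the binary
tree `t`, whose leaves are, from left to right, the edges in the list `L`, which do not come out
of a product. -/
inductive ProdTree (G : LabelledPrograph C P) :
    OutPort C P → BinaryTree Unit → List (OutPort C P) → Prop where
  | leaf (e : OutPort C P) (he : ∀ p : P, e ≠ .prod p) : ProdTree G e .nil [e]
  | node (p : P) (s t : BinaryTree Unit) (K L : List (OutPort C P))
      (hs : ProdTree G (G.wire.symm (.prodL p)) s K)
      (ht : ProdTree G (G.wire.symm (.prodR p)) t L) :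
      ProdTree G (.prod p) (.node () s t) (K ++ L)

/-- The prograph is the gluing of the tree of coproducts `S` with the tree of products `T`:
all the coproducts form the tree `S`, all the products form the tree `T`, the two roots are the
ends of the closing edge, and the `k`-th leaf of `S` is the `k`-th leaf of `T` for every `k`. -/
def IsGluing (G : LabelledPrograph C P) (S T : BinaryTree Unit) : Prop :=
  S.numNodes = Nat.card C ∧ T.numNodes = Nat.card P ∧
    ∃ L : List (OutPort C P),
      CopTree G (.prod G.north) S L ∧ ProdTree G (.prod G.north) T L

end LabelledPrograph

/-- Renaming the operators is an equivalence relation. -/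
def progSetoid (n : ℕ) : Setoid (LabelledPrograph (Fin n) (Fin n)) where
  r := LabelledPrograph.Iso
  iseqv :=
    { refl := fun G => ⟨Equiv.refl _, Equiv.refl _, rfl, by
        intro o
        have h1 : o.map (Equiv.refl (Fin n)) (Equiv.refl (Fin n)) = o := by cases o <;> rfl
        rw [h1]
        cases G.wire o <;> rfl⟩
      symm := by
        rintro G H ⟨f, g, h1, h2⟩
        refine ⟨f.symm, g.symm, by simp [← h1], fun o => ?_⟩
        have h3 : o = (o.map f.symm g.symm).map f g := by cases o <;> simp [OutPort.map]
        have h4 := h2 (o.map f.symm g.symm)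
        rw [← h3] at h4
        rw [h4]
        cases G.wire (o.map f.symm g.symm) <;> simp [InPort.map]
      trans := by
        rintro G H K ⟨f, g, h1, h2⟩ ⟨f', g', h3, h4⟩
        refine ⟨f.trans f', g.trans g', by simp [h1, h3], fun o => ?_⟩
        have h5 : o.map (f.trans f') (g.trans g') = (o.map f g).map f' g' := by cases o <;> rfl
        rw [h5, h4, h2]
        cases G.wire o <;> rfl }

/-- The PC prographs of size `n` (with `n` coproducts and `n` products), up to the names of
the operators. -/
def PCPrograph (n : ℕ) : Type := Quotient (progSetoid n)

namespace PCPrograph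

variable {n : ℕ}

/-- The prograph represented by a labelled one. -/
def mk (G : LabelledPrograph (Fin n) (Fin n)) : PCPrograph n := Quotient.mk (progSetoid n) G

/-- No edge goes from the output of a product to the input of a coproduct. -/
def AvoidsProdCop (Q : PCPrograph n) : Prop :=
  ∀ G : LabelledPrograph (Fin n) (Fin n), mk G = Q → ¬ G.HasProdCopEdge

/-- `R` arises from `Q` by one of the two classical rotations. -/
def Rotation (Q R : PCPrograph n) : Prop :=
  ∃ G H : LabelledPrograph (Fin n) (Fin n), mk G = Q ∧ mk H = R ∧
    (G.CopRotation H ∨ G.ProdRotation H)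

/-- `Q` is the gluing of the tree of coproducts `S` with the tree of products `T`. -/
def IsGluing (Q : PCPrograph n) (S T : BinaryTree Unit) : Prop :=
  ∃ G : LabelledPrograph (Fin n) (Fin n), mk G = Q ∧ G.IsGluing S T

end PCPrograph

/-- The PC prographs of size `n` without an edge from a product output to a coproduct input. -/
def AvoidingPrograph (n : ℕ) : Type := {Q : PCPrograph n // Q.AvoidsProdCop}

/-- `R` is reached from `Q` by a sequence of classical rotations. -/
def AvoidingPrograph.Reaches {n : ℕ} : AvoidingPrograph n → AvoidingPrograph n → Prop :=
  Relation.ReflTransGen fun Q R => PCPrograph.Rotation Q.1 R.1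

/-- `Q ≤ R` if `R` is reached from `Q` by a sequence of classical rotations. -/
instance (n : ℕ) : LE (AvoidingPrograph n) := ⟨AvoidingPrograph.Reaches⟩

/-! ### The Tamari lattice -/

/-- Right rotation at a node of a binary tree: `((a, b), c) ↦ (a, (b, c))`. -/
inductive RightRotation : BinaryTree Unit → BinaryTree Unit → Prop where
  | root (a b c : BinaryTree Unit) :
      RightRotation (.node () (.node () a b) c) (.node () a (.node () b c))
  | left (a a' b : BinaryTree Unit) (h : RightRotation a a') :
      RightRotation (.node () a b) (.node () a' b)
  | right (a b b' : BinaryTree Unit) (h : RightRotation b b') :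
      RightRotation (.node () a b) (.node () a b')

/-- The binary trees with `n` nodes. -/
def Tamari (n : ℕ) : Type := {t : BinaryTree Unit // t.numNodes = n}

/-- `T` is reached from `S` by a sequence of right rotations. -/
def Tamari.Reaches {n : ℕ} (S T : Tamari n) : Prop := Relation.ReflTransGen RightRotation S.1 T.1

/-- `S ≤ T` in the Tamari order if `T` is reached from `S` by a sequence of right rotations. -/
instance (n : ℕ) : LE (Tamari n) := ⟨Tamari.Reaches⟩

/-- The mirror image of a binary tree.  A tree of coproducts grows upwards; turning it by half a
turn, so that it hangs from its root like a tree of products, gives the mirror image of the tree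
read from left to right. -/
def mirror : BinaryTree Unit → BinaryTree Unit
  | .nil => .nil
  | .node _ a b => .node () (mirror b) (mirror a)

/-! Encode a tree by its bracket vector `rightEnd`: nodes are numbered in inorder, and entry `i` is
the last position in the right subtree of node `i`. A right rotation increases one entry and fixes
the others, so reachability implies the componentwise order. Conversely, if the vector of `S` lies
below that of `T`, the node of `S` at the position of the root of `T` can be rotated to the root,
and induction on the subtrees gives `reflTransGen_of_rightEnd_le`. Bracket vectors are the functions
with `i ≤ f i < n` whose intervals `[i, f i]` are nested (`rightEnd_le_rightEnd`,
`exists_rightEnd_eq`). Componentwise minima keep these properties, so all meets exist and the Tamari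
order is a lattice.

In an avoiding prograph the input of each coproduct comes from a coproduct or is the free one, and
the output of each product enters a product or is the free one. Since the graph is finite and
acyclic, the coproducts form one tree and the products another (`SplitsInto`). It remains to see how
the leaves are matched. Each face touches the root or a leaf of the product tree, so there are at
most `n + 2` faces (`SplitsInto.mem_faceList`), while Euler's formula asks for exactly `n + 2`.
Hence the faces at the root and at the leaves are distinct. Reading the contours of both trees
through the same faces then forces the `k`-th leaves to be joined (`SplitsInto.realizes`).
Conversely, a gluing is acyclic and connected, and numbering its contours separates `n + 2` faces,
so it is planar (`Realizes.card_faces`).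

The labelled trees determine the wiring (`Realizes.unique`), and two complete labellings of one
shape differ by a renaming, so avoiding prographs up to isomorphism are pairs of trees. The
coproduct tree is stored in mirrored form, right output first, so that rotation (a) also becomes a
right rotation. Rotations of prographs are then exactly rotations of one component with the other
fixed, and the generated order is the product order. The lattice structure is carried over along
this bijection. -/

/-! ### The Tamari lattice -/

/-- The position, in inorder, of the last node of the right subtree of the `i`-th node (of the node
itself if its right subtree is empty). -/
def rightEnd : BinaryTree Unit → ℕ → ℕ
  | .nil, i => i
  | .node _ a b, i =>
    if i < a.numNodes then rightEnd a i
    else if i = a.numNodes then a.numNodes + b.numNodes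
    else a.numNodes + 1 + rightEnd b (i - (a.numNodes + 1))

theorem le_rightEnd (t : BinaryTree Unit) (i : ℕ) : i ≤ rightEnd t i := by
  induction t generalizing i with
  | nil => simp [rightEnd]
  | node _ a b iha ihb =>
    have h1 := iha i
    have h2 := ihb (i - (a.numNodes + 1))
    simp only [rightEnd]
    split_ifs <;> omega

theorem rightEnd_lt {t : BinaryTree Unit} {i : ℕ} (hi : i < t.numNodes) :
    rightEnd t i < t.numNodes := by
  induction t generalizing i with
  | nil => simp at hi
  | node _ a b iha ihb =>
    simp only [BinaryTree.numNodes] at hi ⊢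
    simp only [rightEnd]
    split_ifs with h1 h2
    · have := iha h1
      omega
    · omega
    · have := ihb (i := i - (a.numNodes + 1)) (by omega)
      omega

/-- The positions after `i` up to `rightEnd t i` are those of the right subtree of node `i`, and
right subtrees inside it cannot leave it. Together with the two bounds above, this nesting
characterises the bracket vectors. -/
theorem rightEnd_le_rightEnd {t : BinaryTree Unit} {i j : ℕ} (hi : i < t.numNodes) (hij : i ≤ j)
    (hj : j ≤ rightEnd t i) : rightEnd t j ≤ rightEnd t i := by
  induction t generalizing i j with
  | nil => simp at hi
  | node _ a b iha ihb =>
    simp only [BinaryTree.numNodes] at hi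
    simp only [rightEnd] at hj ⊢
    by_cases h1 : i < a.numNodes
    · simp only [h1, if_true] at hj ⊢
      have h2 := rightEnd_lt h1
      simp only [show j < a.numNodes by omega, if_true]
      exact iha h1 hij hj
    · by_cases h2 : i = a.numNodes
      · subst h2
        simp only [lt_irrefl, if_false, if_true] at hj ⊢
        split_ifs
        · omega
        · omega
        · have := rightEnd_lt (t := b) (i := j - (a.numNodes + 1)) (by omega)
          omega
      · simp only [h1, h2, if_false] at hj ⊢
        have := ihb (i := i - (a.numNodes + 1)) (j := j - (a.numNodes + 1)) (by omega) (by omega)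
          (by omega)
        split_ifs <;> omega

theorem RightRotation.numNodes_eq {S T : BinaryTree Unit} (h : RightRotation S T) :
    S.numNodes = T.numNodes := by
  induction h with
  | root a b c =>
    simp only [BinaryTree.numNodes]
    omega
  | left a a' b h ih => simp only [BinaryTree.numNodes, ih]
  | right a b b' h ih => simp only [BinaryTree.numNodes, ih]

/-- At `((a, b), c) ↦ (a, (b, c))` inorder positions are preserved. Only the node between `a` and
`b` changes its right subtree, which grows from `b` to `(b, c)`. -/
theorem RightRotation.rightEnd_le {S T : BinaryTree Unit} (h : RightRotation S T) (i : ℕ) :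
    rightEnd S i ≤ rightEnd T i := by
  induction h generalizing i with
  | root a b c =>
    simp only [rightEnd, BinaryTree.numNodes]
    have e : i - (a.numNodes + 1) - (b.numNodes + 1) =
      i - (a.numNodes + b.numNodes + 1 + 1) := by omega
    rw [e]
    by_cases h1 : i < a.numNodes
    · simp [h1, show i < a.numNodes + b.numNodes + 1 by omega]
    · by_cases h2 : i = a.numNodes
      · simp [h2, show a.numNodes < a.numNodes + b.numNodes + 1 by omega]
        omega
      · by_cases h3 : i < a.numNodes + b.numNodes + 1
        · simp [h1, h2, h3, show i - (a.numNodes + 1) < b.numNodes by omega]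
        · by_cases h4 : i = a.numNodes + b.numNodes + 1
          · have h5 : i - (a.numNodes + 1) = b.numNodes := by omega
            simp only [h1, h2, h3, h5, if_false, lt_irrefl, if_true]
            simp only [h4, if_true]
            omega
          · simp only [h1, h2, h3, h4, if_false, show ¬ i - (a.numNodes + 1) < b.numNodes by omega,
              show ¬ i - (a.numNodes + 1) = b.numNodes by omega]
            omega
  | left a a' b h ih =>
    have := h.numNodes_eq
    have := ih i
    simp only [rightEnd]
    split_ifs <;> simp_all
  | right a b b' h ih =>
    have := h.numNodes_eq
    have := ih (i - (a.numNodes + 1))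
    simp only [rightEnd]
    split_ifs <;> omega

/-- The strict increase occurs at the lower node of the rotated pair; it rules out cycles of
rotations. -/
theorem RightRotation.exists_rightEnd_lt {S T : BinaryTree Unit} (h : RightRotation S T) :
    ∃ i < S.numNodes, rightEnd S i < rightEnd T i := by
  induction h with
  | root a b c =>
    refine ⟨a.numNodes, ?_, ?_⟩
    · simp only [BinaryTree.numNodes]
      omega
    · simp only [rightEnd, BinaryTree.numNodes]
      split_ifs <;> omega
  | left a a' b h ih =>
    obtain ⟨i, hi, hlt⟩ := ih
    refine ⟨i, ?_, ?_⟩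
    · simp only [BinaryTree.numNodes]
      omega
    · simpa [rightEnd, hi, ← h.numNodes_eq] using hlt
  | right a b b' h ih =>
    obtain ⟨i, hi, hlt⟩ := ih
    refine ⟨a.numNodes + 1 + i, ?_, ?_⟩
    · simp only [BinaryTree.numNodes]
      omega
    · simp only [rightEnd]
      split_ifs
      · omega
      · omega
      · simpa using hlt

/-! ### Reachability by rotations and comparison of bracket vectors -/

open Relation

theorem reflTransGen_node_left {a a' : BinaryTree Unit} (b : BinaryTree Unit)
    (h : ReflTransGen RightRotation a a') :
    ReflTransGen RightRotation (.node () a b) (.node () a' b) :=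
  h.lift (fun t => BinaryTree.node () t b) fun _ _ => RightRotation.left _ _ _

theorem reflTransGen_node_right (a : BinaryTree Unit) {b b' : BinaryTree Unit}
    (h : ReflTransGen RightRotation b b') :
    ReflTransGen RightRotation (.node () a b) (.node () a b') :=
  h.lift (fun t => BinaryTree.node () a t) fun _ _ => RightRotation.right _ _ _

theorem reflTransGen_numNodes_eq {S T : BinaryTree Unit} (h : ReflTransGen RightRotation S T) :
    S.numNodes = T.numNodes := by
  induction h with
  | refl => rfl
  | tail _ h ih => rw [ih, h.numNodes_eq]

theorem reflTransGen_rightEnd_le {S T : BinaryTree Unit} (h : ReflTransGen RightRotation S T)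
    (i : ℕ) : rightEnd S i ≤ rightEnd T i := by
  induction h with
  | refl => rfl
  | tail _ h ih => exact ih.trans (h.rightEnd_le i)

theorem reflTransGen_antisymm {S T : BinaryTree Unit} (h : ReflTransGen RightRotation S T)
    (h' : ReflTransGen RightRotation T S) : S = T := by
  rcases ReflTransGen.cases_head h with rfl | ⟨S', h1, h2⟩
  · rfl
  · obtain ⟨i, -, hi⟩ := h1.exists_rightEnd_lt
    have := reflTransGen_rightEnd_le (h2.trans h') i
    omega

/-- A node in whose way no right subtree stands can be rotated up to the root. -/
theorem exists_reflTransGen_node {S : BinaryTree Unit} {k : ℕ} (hk : k < S.numNodes)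
    (h : ∀ i < k, rightEnd S i < k) :
    ∃ a b, a.numNodes = k ∧ ReflTransGen RightRotation S (.node () a b) ∧
      (∀ i < k, rightEnd a i = rightEnd S i) ∧
      ∀ i < b.numNodes, k + 1 + rightEnd b i = rightEnd S (k + 1 + i) := by
  induction S with
  | nil => simp at hk
  | node _ S T ihS ihT =>
    rcases lt_trichotomy S.numNodes k with hlt | rfl | hlt
    -- A root to the left of `k` has a right subtree reaching the last position, which is at least
    -- `k`, against `h`.
    · have h1 := h _ hlt
      simp only [rightEnd, lt_irrefl, if_false, if_true, BinaryTree.numNodes] at h1 hk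
      omega
    · refine ⟨S, T, rfl, .refl, fun i hi => ?_, fun i hi => ?_⟩
      · simp [rightEnd, hi]
      · simp only [rightEnd]
        split_ifs
        · omega
        · omega
        · simp
    -- Here node `k` lies in the left subtree: it is lifted to the root of that subtree, and one
    -- more rotation carries it over the old root.
    · obtain ⟨a, b, ha, hr, h1, h2⟩ := ihS hlt fun i hi => by
        have := h i hi
        simpa [rightEnd, hi.trans hlt] using this
      have hn := reflTransGen_numNodes_eq hr
      simp only [BinaryTree.numNodes] at hn
      refine ⟨a, .node () b T, ha, (reflTransGen_node_left T hr).tail (.root a b T),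
        fun i hi => ?_, fun i hi => ?_⟩
      · simp [rightEnd, hi.trans hlt, h1 i hi]
      · have h3 := h2 i
        simp only [rightEnd]
        have e : k + 1 + i - (S.numNodes + 1) = i - (b.numNodes + 1) := by omega
        rw [e]
        split_ifs <;> omega

/-- Nodes of `T` before its root have right subtrees ending before the root. By comparison the same
holds in `S`, so `exists_reflTransGen_node` brings the node at that position to the root of `S`
without disturbing the vectors of the two sides, which are compared recursively. -/
theorem reflTransGen_of_rightEnd_le {S T : BinaryTree Unit} (hn : S.numNodes = T.numNodes)
    (h : ∀ i < T.numNodes, rightEnd S i ≤ rightEnd T i) : ReflTransGen RightRotation S T := by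
  induction T generalizing S with
  | nil =>
    cases S with
    | nil => exact .refl
    | node _ a b => simp at hn
  | node _ A B ihA ihB =>
    have hT : ∀ i < A.numNodes, rightEnd (.node () A B) i = rightEnd A i := fun i hi => by
      simp [rightEnd, hi]
    have hT' : ∀ i, rightEnd (.node () A B) (A.numNodes + 1 + i) =
        A.numNodes + 1 + rightEnd B i := fun i => by
      simp only [rightEnd]
      split_ifs
      · omega
      · omega
      · simp
    simp only [BinaryTree.numNodes] at hn h
    obtain ⟨a, b, ha, hr, h1, h2⟩ := exists_reflTransGen_node (S := S) (k := A.numNodes)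
      (by omega) fun i hi => by
        have := h i (by omega)
        rw [hT i hi] at this
        exact this.trans_lt (rightEnd_lt hi)
    have hn' := reflTransGen_numNodes_eq hr
    simp only [BinaryTree.numNodes] at hn'
    refine hr.trans ((reflTransGen_node_left b (ihA ha fun i hi => ?_)).trans
      (reflTransGen_node_right A (ihB (by omega) fun i hi => ?_)))
    · rw [h1 i hi, ← hT i hi]
      exact h i (by omega)
    · have h3 := h (A.numNodes + 1 + i) (by omega)
      rw [hT', ← h2 i (by omega)] at h3
      omega

/-- Every function that has the properties of `rightEnd` comes from a tree. -/
theorem exists_rightEnd_eq (n : ℕ) (f : ℕ → ℕ) (hle : ∀ i < n, i ≤ f i) (hlt : ∀ i < n, f i < n)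
    (hf : ∀ i < n, ∀ j, i ≤ j → j ≤ f i → f j ≤ f i) :
    ∃ t : BinaryTree Unit, t.numNodes = n ∧ ∀ i < n, rightEnd t i = f i := by
  induction n using Nat.strong_induction_on generalizing f with
  | _ n ih =>
    rcases Nat.eq_zero_or_pos n with rfl | hn
    · exact ⟨.nil, rfl, by simp⟩
    -- The root has to be the first position whose interval reaches the end `n - 1`.
    have hex : ∃ k, k < n ∧ f k + 1 = n := ⟨n - 1, by omega, by
      have := hle (n - 1) (by omega)
      have := hlt (n - 1) (by omega)
      omega⟩
    classical
    obtain ⟨k, ⟨hkn, hk⟩, hmin⟩ : ∃ k, (k < n ∧ f k + 1 = n) ∧ ∀ i < k, ¬ (i < n ∧ f i + 1 = n) :=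
      ⟨Nat.find hex, Nat.find_spec hex, fun i hi => Nat.find_min hex hi⟩
    -- If an earlier interval contained `k`, nesting would make it reach `n - 1` too, against the
    -- minimality of `k`.
    have hpre : ∀ i < k, f i < k := fun i hi => by
      by_contra hcon
      have := hf i (by omega) k hi.le (by omega)
      have := hlt i (by omega)
      exact hmin i hi ⟨by omega, by omega⟩
    obtain ⟨a, ha, ha'⟩ := ih k hkn f (fun i hi => hle i (by omega)) hpre
      fun i hi => hf i (by omega)
    obtain ⟨b, hb, hb'⟩ := ih (n - (k + 1)) (by omega) (fun i => f (k + 1 + i) - (k + 1))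
      (fun i hi => by
        have := hle (k + 1 + i) (by omega)
        omega)
      (fun i hi => by
        have := hlt (k + 1 + i) (by omega)
        have := hle (k + 1 + i) (by omega)
        omega)
      (fun i hi j hij hj => by
        have := hf (k + 1 + i) (by omega) (k + 1 + j) (by omega)
          (by have := hle (k + 1 + i) (by omega); omega)
        omega)
    refine ⟨.node () a b, by simp only [BinaryTree.numNodes]; omega, fun i hi => ?_⟩
    simp only [rightEnd, ha, hb]
    split_ifs with h1 h2
    · exact ha' i h1
    · subst h2
      omega
    · rw [hb' _ (by omega)]
      have e : k + 1 + (i - (k + 1)) = i := by omega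
      have := hle i hi
      simp only [e]
      omega

/-! ### Meets in the Tamari order -/

theorem Tamari.reaches_iff {n : ℕ} (S T : Tamari n) :
    S.Reaches T ↔ ∀ i < n, rightEnd S.1 i ≤ rightEnd T.1 i := by
  refine ⟨fun h i _ => reflTransGen_rightEnd_le h i, fun h => ?_⟩
  exact reflTransGen_of_rightEnd_le (S.2.trans T.2.symm) (by rwa [T.2])

theorem Tamari.exists_greatest_lower_bound {n : ℕ} (𝒮 : Set (Tamari n)) :
    ∃ M : Tamari n, (∀ T ∈ 𝒮, M.Reaches T) ∧
      ∀ M' : Tamari n, (∀ T ∈ 𝒮, M'.Reaches T) → M'.Reaches M := by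
  classical
  -- The entry `n - 1` bounds all entries of bracket vectors, so inserting it does not affect the
  -- minimum over a nonempty family. For the empty family it yields the greatest vector.
  let A : ℕ → Set ℕ := fun i => insert (n - 1) ((fun T : Tamari n => rightEnd T.1 i) '' 𝒮)
  have hne : ∀ i, (A i).Nonempty := fun i => Set.insert_nonempty _ _
  have hmem : ∀ i, sInf (A i) ∈ A i := fun i => Nat.sInf_mem (hne i)
  have hle : ∀ i, ∀ a ∈ A i, sInf (A i) ≤ a := fun i a ha => Nat.sInf_le ha
  obtain ⟨t, ht, ht'⟩ := exists_rightEnd_eq n (fun i => sInf (A i))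
    (fun i hi => by
      rcases hmem i with h | ⟨T, -, h⟩
      · rw [h]
        omega
      · rw [← h]
        exact le_rightEnd _ _)
    (fun i hi => (hle i _ (Set.mem_insert _ _)).trans_lt (by omega))
    (fun i hi j hij hj => by
      rcases hmem i with h | ⟨T, hT, h⟩
      · rw [h]
        exact hle j _ (Set.mem_insert _ _)
      · simp only at h hj ⊢
        rw [← h] at hj ⊢
        exact (hle j _ (Or.inr ⟨T, hT, rfl⟩)).trans
          (rightEnd_le_rightEnd (by rwa [T.2]) hij hj))
  refine ⟨⟨t, ht⟩, fun T hT => ?_, fun M hM => ?_⟩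
  · refine (Tamari.reaches_iff _ _).2 fun i hi => ?_
    rw [ht' i hi]
    exact hle i _ (Or.inr ⟨T, hT, rfl⟩)
  · refine (Tamari.reaches_iff _ _).2 fun i hi => ?_
    rw [ht' i hi]
    rcases hmem i with h | ⟨T, hT, h⟩
    · rw [h]
      have := rightEnd_lt (t := M.1) (i := i) (by rwa [M.2])
      rw [M.2] at this
      omega
    · rw [← h]
      exact (Tamari.reaches_iff _ _).1 (hM T hT) i hi

/-- Arbitrary meets suffice: joins are meets of upper bounds. -/
theorem Tamari.exists_lattice (n : ℕ) :
    ∃ L : Lattice (Tamari n), ∀ S T : Tamari n, L.le S T ↔ S.Reaches T := by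
  let _ : PartialOrder (Tamari n) :=
    { le := Tamari.Reaches
      le_refl := fun _ => ReflTransGen.refl
      le_trans := fun _ _ _ => ReflTransGen.trans
      le_antisymm := fun _ _ h h' => Subtype.ext (reflTransGen_antisymm h h') }
  let _ : InfSet (Tamari n) := ⟨fun 𝒮 => (Tamari.exists_greatest_lower_bound 𝒮).choose⟩
  have hglb : ∀ 𝒮 : Set (Tamari n), IsGLB 𝒮 (sInf 𝒮) := fun 𝒮 =>
    ⟨fun T hT => (Tamari.exists_greatest_lower_bound 𝒮).choose_spec.1 T hT,
      fun M hM => (Tamari.exists_greatest_lower_bound 𝒮).choose_spec.2 M fun _ hT => hM hT⟩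
  exact ⟨(completeLatticeOfInf (Tamari n) hglb).toLattice, fun _ _ => Iff.rfl⟩

/-! ### Unfolding a graph into a labelled binary tree -/

namespace BinaryTree

variable {N N' : Type}

/-- The labels of the nodes, in preorder. -/
def labels : BinaryTree N → List N
  | .nil => []
  | .node c s t => c :: (labels s ++ labels t)

/-- The underlying unlabelled tree. -/
def shape (t : BinaryTree N) : BinaryTree Unit := t.map fun _ => ()

theorem length_labels (t : BinaryTree N) : t.labels.length = t.numNodes := by
  induction t with
  | nil => rfl
  | node c s t ihs iht => simp [labels, ihs, iht]

theorem numNodes_shape (t : BinaryTree N) : t.shape.numNodes = t.numNodes := by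
  induction t with
  | nil => rfl
  | node c s t ihs iht => simpa [shape, map] using congrArg₂ (· + ·) ihs iht

theorem labels_map (f : N → N') (t : BinaryTree N) : (t.map f).labels = t.labels.map f := by
  induction t with
  | nil => rfl
  | node c s t ihs iht => simp [labels, map, ihs, iht]

theorem shape_map (f : N → N') (t : BinaryTree N) : (t.map f).shape = t.shape :=
  (comp_map f _ t).symm

theorem eq_of_shape_of_labels {s t : BinaryTree N} (h : s.shape = t.shape)
    (h' : s.labels = t.labels) : s = t := by
  induction s generalizing t with
  | nil =>
    cases t with
    | nil => rfl
    | node c t u => simp [labels] at h'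
  | node c s s' ih ih' =>
    cases t with
    | nil => simp [labels] at h'
    | node d t t' =>
      simp only [shape, map, node.injEq, true_and] at h
      simp only [labels, List.cons.injEq] at h'
      have hl : s.labels.length = t.labels.length := by
        rw [length_labels, length_labels, ← numNodes_shape s, ← numNodes_shape t, shape, h.1, shape]
      obtain ⟨h1, h2⟩ := List.append_inj h'.2 hl
      rw [h'.1, ih h.1 h1, ih' h.2 h2]

theorem exists_shape_eq_labels_eq (S : BinaryTree Unit) (l : List N) (h : l.length = S.numNodes) :
    ∃ t : BinaryTree N, t.shape = S ∧ t.labels = l := by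
  induction S generalizing l with
  | nil => exact ⟨.nil, rfl, (List.eq_nil_of_length_eq_zero h).symm⟩
  | node _ S T ihS ihT =>
    cases l with
    | nil => simp at h
    | cons c l =>
      simp only [numNodes, List.length_cons] at h
      obtain ⟨s, hs, hs'⟩ := ihS (l.take S.numNodes) (by rw [List.length_take]; omega)
      obtain ⟨t, ht, ht'⟩ := ihT (l.drop S.numNodes) (by rw [List.length_drop]; omega)
      exact ⟨.node c s t, by simp [shape, map, ← hs, ← ht], by simp [labels, hs', ht']⟩

/-- Two complete labellings of the same tree differ by a bijection of the labels. -/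
theorem exists_equiv_map_eq {s : BinaryTree N} {t : BinaryTree N'} (h : s.shape = t.shape)
    (hs : s.labels.Nodup) (hs' : ∀ c, c ∈ s.labels) (ht : t.labels.Nodup)
    (ht' : ∀ c, c ∈ t.labels) : ∃ f : N ≃ N', s.map f = t := by
  classical
  have hl : s.labels.length = t.labels.length := by
    rw [length_labels, length_labels, ← numNodes_shape s, ← numNodes_shape t, h]
  refine ⟨(hs.getEquivOfForallMemList _ hs').symm.trans
    ((finCongr hl).trans (ht.getEquivOfForallMemList _ ht')), eq_of_shape_of_labels ?_ ?_⟩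
  · rw [shape_map, h]
  · rw [labels_map]
    refine List.ext_getElem (by simpa using hl) fun i h1 h2 => ?_
    rw [List.length_map] at h1
    have e : (hs.getEquivOfForallMemList _ hs').symm s.labels[i] = ⟨i, h1⟩ := by
      rw [Equiv.symm_apply_eq]
      rfl
    simp only [List.getElem_map, Equiv.trans_apply, e]
    rfl

end BinaryTree

open BinaryTree

section Unfolding

variable {N X : Type}

/-- Let the edge `κ c` enter the node `c`, and let the edges `L c` and `R c` leave it.
`Unfolds κ L R v t`: starting with the edge `v` one reads the labelled tree `t`, whose leaves do not
enter a node. -/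
def Unfolds (κ L R : N → X) : X → BinaryTree N → Prop
  | v, .nil => ∀ c, v ≠ κ c
  | v, .node c s t => v = κ c ∧ Unfolds κ L R (L c) s ∧ Unfolds κ L R (R c) t

/-- The leaves of an unfolded tree, from left to right. -/
def leafList (L R : N → X) : X → BinaryTree N → List X
  | v, .nil => [v]
  | _, .node c s t => leafList L R (L c) s ++ leafList L R (R c) t

/-- All the edges of an unfolded tree. -/
def edgeList (L R : N → X) (v : X) (t : BinaryTree N) : List X :=
  v :: t.labels.flatMap fun c => [L c, R c]

variable {κ L R L' R' : N → X} {v v' : X} {t : BinaryTree N}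

theorem edgeList_node_perm (c : N) (s t : BinaryTree N) :
    (edgeList L R v (.node c s t)).Perm
      (v :: (edgeList L R (L c) s ++ edgeList L R (R c) t)) := by
  simp only [edgeList, labels, List.flatMap_cons, List.flatMap_append, List.cons_append,
    List.nil_append, List.perm_cons]
  exact List.perm_middle.symm

theorem mem_edgeList_node {c : N} {s t : BinaryTree N} {x : X} :
    x ∈ edgeList L R v (.node c s t) ↔
      x = v ∨ x ∈ edgeList L R (L c) s ∨ x ∈ edgeList L R (R c) t := by
  rw [(edgeList_node_perm c s t).mem_iff, List.mem_cons, List.mem_append]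

theorem self_mem_edgeList : v ∈ edgeList L R v t := List.mem_cons_self

theorem left_mem_edgeList {c : N} (hc : c ∈ t.labels) : L c ∈ edgeList L R v t :=
  List.mem_cons_of_mem _ (List.mem_flatMap.2 ⟨c, hc, by simp⟩)

theorem right_mem_edgeList {c : N} (hc : c ∈ t.labels) : R c ∈ edgeList L R v t :=
  List.mem_cons_of_mem _ (List.mem_flatMap.2 ⟨c, hc, by simp⟩)

theorem length_leafList (L R : N → X) (v : X) (t : BinaryTree N) :
    (leafList L R v t).length = t.numNodes + 1 := by
  induction t generalizing v with
  | nil => rfl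
  | node c s t ihs iht =>
    simp only [leafList, List.length_append, ihs, iht, numNodes]
    omega

theorem leafList_comp {Y : Type} (β : Y → X) (l r : N → Y) (y : Y) (t : BinaryTree N) :
    leafList (β ∘ l) (β ∘ r) (β y) t = (leafList l r y t).map β := by
  induction t generalizing y with
  | nil => rfl
  | node c s t ihs iht => simp [leafList, ← ihs, ← iht]

namespace Unfolds

theorem unique (hκ : Function.Injective κ) {t' : BinaryTree N} (h : Unfolds κ L R v t)
    (h' : Unfolds κ L R v t') : t = t' := by
  induction t generalizing v t' with
  | nil =>
    cases t' with
    | nil => rfl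
    | node c s u => exact absurd h'.1 (h c)
  | node c s u ihs ihu =>
    cases t' with
    | nil => exact absurd h.1 (h' c)
    | node d s' u' =>
      obtain rfl : c = d := hκ (h.1.symm.trans h'.1)
      rw [ihs h.2.1 h'.2.1, ihu h.2.2 h'.2.2]

theorem eq_node (h : Unfolds κ L R v t) {c : N} (hv : v = κ c) (hκ : Function.Injective κ) :
    ∃ s u, t = .node c s u := by
  cases t with
  | nil => exact absurd hv (h c)
  | node d s u =>
    obtain rfl : d = c := hκ (h.1.symm.trans hv)
    exact ⟨s, u, rfl⟩

/-- Each edge met while unfolding either enters a node or is a leaf. Counted with multiplicity, this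
reduces questions about labels to questions about edges. -/
theorem edgeList_perm (h : Unfolds κ L R v t) :
    (edgeList L R v t).Perm (t.labels.map κ ++ leafList L R v t) := by
  induction t generalizing v with
  | nil => simp [edgeList, leafList, labels]
  | node c s u ihs ihu =>
    refine (edgeList_node_perm c s u).trans ?_
    simp only [labels, leafList, List.map_cons, List.map_append, List.cons_append, ← h.1,
      List.perm_cons]
    refine ((ihs h.2.1).append (ihu h.2.2)).trans ?_
    simp only [List.append_assoc]
    refine List.Perm.append_left _ ?_
    simp only [← List.append_assoc]
    exact List.perm_append_comm.append_right _

theorem ne_of_mem_leafList (h : Unfolds κ L R v t) {x : X} (hx : x ∈ leafList L R v t) (c : N) :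
    x ≠ κ c := by
  induction t generalizing v with
  | nil =>
    rw [leafList, List.mem_singleton] at hx
    exact hx ▸ h c
  | node d s u ihs ihu =>
    rcases List.mem_append.1 hx with hx | hx
    · exact ihs h.2.1 hx
    · exact ihu h.2.2 hx

theorem mem_edgeList_of_mem_leafList (h : Unfolds κ L R v t) {x : X}
    (hx : x ∈ leafList L R v t) : x ∈ edgeList L R v t :=
  h.edgeList_perm.mem_iff.2 (List.mem_append_right _ hx)

theorem mem_leafList_of_ne (h : Unfolds κ L R v t) {x : X} (hx : x ∈ edgeList L R v t)
    (hx' : ∀ c, x ≠ κ c) : x ∈ leafList L R v t := by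
  rcases List.mem_append.1 (h.edgeList_perm.mem_iff.1 hx) with h1 | h1
  · obtain ⟨c, -, rfl⟩ := List.mem_map.1 h1
    exact absurd rfl (hx' c)
  · exact h1

theorem mem_labels_iff (h : Unfolds κ L R v t) (hκ : Function.Injective κ) {c : N} :
    c ∈ t.labels ↔ κ c ∈ edgeList L R v t := by
  rw [h.edgeList_perm.mem_iff, List.mem_append]
  refine ⟨fun hc => Or.inl (List.mem_map_of_mem hc), ?_⟩
  rintro (hc | hc)
  · exact (List.mem_map_of_injective hκ).1 hc
  · exact absurd rfl (h.ne_of_mem_leafList hc c)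

theorem count_labels [DecidableEq N] [DecidableEq X] (h : Unfolds κ L R v t)
    (hκ : Function.Injective κ) (c : N) :
    t.labels.count c = (edgeList L R v t).count (κ c) := by
  rw [h.edgeList_perm.count_eq, List.count_append, List.count_map_of_injective _ _ hκ,
    List.count_eq_zero_of_not_mem fun hc => h.ne_of_mem_leafList hc c rfl, add_zero]

end Unfolds

/-- The tree structure of the edges: every edge has at most one end, and the root is not the start
of a node. -/
structure Branching (κ L R : N → X) (v : X) : Prop where
  inj : Function.Injective κ
  left_inj : Function.Injective L
  right_inj : Function.Injective R
  left_ne_right : ∀ c d, L c ≠ R d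
  root_ne_left : ∀ c, v ≠ L c
  root_ne_right : ∀ c, v ≠ R c

theorem Branching.nodup_edgeList (hB : Branching κ L R v) (hl : t.labels.Nodup) :
    (edgeList L R v t).Nodup := by
  refine List.nodup_cons.2 ⟨fun hv => ?_, List.nodup_flatMap.2 ⟨fun c _ => ?_, ?_⟩⟩
  · obtain ⟨c, -, hc⟩ := List.mem_flatMap.1 hv
    simp only [List.mem_cons, List.not_mem_nil, or_false] at hc
    exact hc.elim (hB.root_ne_left c) (hB.root_ne_right c)
  · simpa using hB.left_ne_right c c
  · refine hl.imp fun {c d} hcd x hx hx' => ?_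
    simp only [List.mem_cons, List.not_mem_nil, or_false] at hx hx'
    rcases hx with rfl | rfl <;> rcases hx' with hx' | hx'
    · exact hcd (hB.left_inj hx')
    · exact hB.left_ne_right _ _ hx'
    · exact hB.left_ne_right _ _ hx'.symm
    · exact hcd (hB.right_inj hx')

theorem Branching.count_left [DecidableEq N] [DecidableEq X] (hB : Branching κ L R v) (l : List N)
    (d : N) : (l.flatMap fun c => [L c, R c]).count (L d) = l.count d := by
  induction l with
  | nil => rfl
  | cons c l ih =>
    simp only [List.flatMap_cons, List.cons_append, List.nil_append, List.count_cons, ih,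
      beq_iff_eq, (hB.left_ne_right d c).symm, if_false, hB.left_inj.eq_iff, add_zero]

theorem Branching.count_right [DecidableEq N] [DecidableEq X] (hB : Branching κ L R v) (l : List N)
    (d : N) : (l.flatMap fun c => [L c, R c]).count (R d) = l.count d := by
  induction l with
  | nil => rfl
  | cons c l ih =>
    simp only [List.flatMap_cons, List.cons_append, List.nil_append, List.count_cons, ih,
      beq_iff_eq, hB.left_ne_right c d, if_false, hB.right_inj.eq_iff, add_zero]

/-- In a graph without cycles no node occurs twice in an unfolded tree. -/
theorem Unfolds.nodup_labels (hB : Branching κ L R v) (h : Unfolds κ L R v t)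
    (hw : WellFounded fun c d => κ d = L c ∨ κ d = R c) : t.labels.Nodup := by
  classical
  refine List.nodup_iff_count_le_one.2 fun c => ?_
  induction c using hw.induction with
  | _ c ih =>
    -- A node occurs as often as the edge entering it. That edge is the root, which is no output of
    -- a node, or an output of a parent `d`, listed as often as `d` itself.
    rw [h.count_labels hB.inj, edgeList, List.count_cons]
    by_cases hv : κ c = v
    · rw [hv, List.count_eq_zero_of_not_mem]
      · simp
      · intro hm
        obtain ⟨d, -, hd⟩ := List.mem_flatMap.1 hm
        simp only [List.mem_cons, List.not_mem_nil, or_false] at hd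
        exact hd.elim (hB.root_ne_left d) (hB.root_ne_right d)
    · simp only [beq_iff_eq, Ne.symm hv, if_false, add_zero]
      by_cases hd : ∃ d, κ c = L d ∨ κ c = R d
      · obtain ⟨d, hd⟩ := hd
        have h1 := ih d hd
        rcases hd with hd | hd
        · rwa [hd, hB.count_left]
        · rwa [hd, hB.count_right]
      · rw [List.count_eq_zero_of_not_mem]
        · exact Nat.zero_le _
        · intro hm
          obtain ⟨d, -, h1⟩ := List.mem_flatMap.1 hm
          simp only [List.mem_cons, List.not_mem_nil, or_false] at h1
          exact hd ⟨d, h1⟩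

/-- A node occurs in an unfolded tree if all the nodes below it have predecessors. -/
theorem Unfolds.mem_labels (hκ : Function.Injective κ) (h : Unfolds κ L R v t)
    (hw : WellFounded fun c d => κ d = L c ∨ κ d = R c)
    (hp : ∀ c, κ c = v ∨ ∃ d, κ c = L d ∨ κ c = R d) (c : N) : c ∈ t.labels := by
  induction c using hw.induction with
  | _ c ih =>
    rw [h.mem_labels_iff hκ]
    rcases hp c with hv | ⟨d, hd | hd⟩
    · exact hv ▸ self_mem_edgeList
    · exact hd ▸ left_mem_edgeList (ih d (Or.inl hd))
    · exact hd ▸ right_mem_edgeList (ih d (Or.inr hd))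

/-- Well-foundedness is assumed with children below their parents, so the recursion away from the
root terminates. -/
theorem exists_unfolds (hw : WellFounded fun d c => κ d = L c ∨ κ d = R c) (v : X) :
    ∃ t, Unfolds κ L R v t := by
  have key : ∀ c, ∃ t, Unfolds κ L R (κ c) t := fun c => by
    induction c using hw.induction with
    | _ c ih =>
      have h1 : ∀ x, (x = L c ∨ x = R c) → ∃ t, Unfolds κ L R x t := fun x hx => by
        by_cases h : ∃ d, x = κ d
        · obtain ⟨d, rfl⟩ := h
          exact ih d hx
        · exact ⟨.nil, fun d hd => h ⟨d, hd⟩⟩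
      obtain ⟨s, hs⟩ := h1 _ (Or.inl rfl)
      obtain ⟨u, hu⟩ := h1 _ (Or.inr rfl)
      exact ⟨.node c s u, rfl, hs, hu⟩
  by_cases h : ∃ d, v = κ d
  · obtain ⟨d, rfl⟩ := h
    exact key d
  · exact ⟨.nil, fun d hd => h ⟨d, hd⟩⟩

/-! #### Change of the graph -/

/-- Unfolding only asks which node, if any, an edge enters. Leaf edges may therefore be replaced by
other leaf edges, as happens to one tree when the other is rotated. -/
theorem Unfolds.congr (h : Unfolds κ L R v t) (hv : ∀ c, v = κ c ↔ v' = κ c)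
    (hLR : ∀ z ∈ t.labels, ∀ c, (L z = κ c ↔ L' z = κ c) ∧ (R z = κ c ↔ R' z = κ c)) :
    Unfolds κ L' R' v' t := by
  induction t generalizing v v' with
  | nil => exact fun c hc => h c ((hv c).2 hc)
  | node c s u ihs ihu =>
    simp only [labels, List.mem_cons, List.mem_append] at hLR
    exact ⟨(hv c).1 h.1,
      ihs h.2.1 (fun d => (hLR c (Or.inl rfl) d).1) fun z hz => hLR z (by simp [hz]),
      ihu h.2.2 (fun d => (hLR c (Or.inl rfl) d).2) fun z hz => hLR z (by simp [hz])⟩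

theorem Unfolds.congr_eq (h : Unfolds κ L R v t)
    (hLR : ∀ z ∈ t.labels, L' z = L z ∧ R' z = R z) : Unfolds κ L' R' v t :=
  h.congr (fun _ => Iff.rfl) fun z hz c => by rw [(hLR z hz).1, (hLR z hz).2]; simp

theorem leafList_congr (hLR : ∀ z ∈ t.labels, L' z = L z ∧ R' z = R z) (v : X) :
    leafList L' R' v t = leafList L R v t := by
  induction t generalizing v with
  | nil => rfl
  | node c s u ihs ihu =>
    simp only [labels, List.mem_cons, List.mem_append] at hLR
    simp only [leafList]
    rw [ihs fun z hz => hLR z (by simp [hz]), ihu fun z hz => hLR z (by simp [hz]),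
      (hLR c (Or.inl rfl)).1, (hLR c (Or.inl rfl)).2]

theorem Unfolds.root_iff (h : Unfolds κ L R v t)
    (h' : Unfolds κ L' R' v' t) (c : N) : v = κ c ↔ v' = κ c := by
  cases t with
  | nil => exact ⟨fun e => absurd e (h c), fun e => absurd e (h' c)⟩
  | node d s u => rw [h.1, h'.1]

/-- The labelled tree alone fixes the inner edges; only the leaves remain free. -/
theorem Unfolds.inner_iff (h : Unfolds κ L R v t)
    (h' : Unfolds κ L' R' v' t) {z : N} (hz : z ∈ t.labels) (c : N) :
    (L z = κ c ↔ L' z = κ c) ∧ (R z = κ c ↔ R' z = κ c) := by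
  induction t generalizing v v' with
  | nil => simp [labels] at hz
  | node d s u ihs ihu =>
    simp only [labels, List.mem_cons, List.mem_append] at hz
    rcases hz with rfl | hz | hz
    · exact ⟨h.2.1.root_iff h'.2.1 c, h.2.2.root_iff h'.2.2 c⟩
    · exact ihs h.2.1 h'.2.1 hz
    · exact ihu h.2.2 h'.2.2 hz

/-- The labelled tree and its leaves determine all the edges. -/
theorem Unfolds.eq_of_leafList_eq (h : Unfolds κ L R v t) (h' : Unfolds κ L' R' v' t)
    (hf : leafList L R v t = leafList L' R' v' t) :
    v = v' ∧ ∀ z ∈ t.labels, L z = L' z ∧ R z = R' z := by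
  induction t generalizing v v' with
  | nil => simpa [leafList, labels] using hf
  | node c s u ihs ihu =>
    obtain ⟨h1, h2⟩ := List.append_inj hf (by simp only [length_leafList])
    obtain ⟨e1, h3⟩ := ihs h.2.1 h'.2.1 h1
    obtain ⟨e2, h4⟩ := ihu h.2.2 h'.2.2 h2
    refine ⟨h.1.trans h'.1.symm, fun z hz => ?_⟩
    simp only [labels, List.mem_cons, List.mem_append] at hz
    rcases hz with rfl | hz | hz
    · exact ⟨e1, e2⟩
    · exact h3 z hz
    · exact h4 z hz

theorem Unfolds.map {N' X' : Type} {κ' l r : N' → X'} {f : N → N'} {ξ : X → X'}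
    (h : Unfolds κ L R v t) (hκ : ∀ c, ξ (κ c) = κ' (f c))
    (hξ : ∀ x, (∀ c, x ≠ κ c) → ∀ c, ξ x ≠ κ' c) (hl : ∀ c, l (f c) = ξ (L c))
    (hr : ∀ c, r (f c) = ξ (R c)) : Unfolds κ' l r (ξ v) (t.map f) := by
  induction t generalizing v with
  | nil => exact hξ v h
  | node c s u ihs ihu =>
    refine ⟨by rw [h.1, hκ], ?_, ?_⟩
    · rw [hl]
      exact ihs h.2.1
    · rw [hr]
      exact ihu h.2.2

theorem leafList_map {N' X' : Type} {l r : N' → X'} {f : N → N'} {ξ : X → X'}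
    (hl : ∀ c, l (f c) = ξ (L c)) (hr : ∀ c, r (f c) = ξ (R c)) (v : X) (t : BinaryTree N) :
    leafList l r (ξ v) (t.map f) = (leafList L R v t).map ξ := by
  induction t generalizing v with
  | nil => rfl
  | node c s u ihs ihu =>
    simp only [leafList, BinaryTree.map, List.map_append]
    rw [hl, hr, ihs, ihu]

/-! #### Rotations -/

/-- The edges `L', R'` arise from `L, R` by a rotation at the nodes `x` and `y`. -/
structure RotatesAt (κ L R L' R' : N → X) (x y : N) : Prop where
  left : L x = κ y
  right' : R' x = κ y
  left_eq : L' x = L y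
  mid_eq : L' y = R y
  right_eq : R' y = R x

/-- Since no label is repeated, the nodes `x` and `y` are absent from the three subtrees hanging at
them and from the rest of the tree. These parts unfold as before, and the order of the leaves is
kept. -/
theorem Unfolds.exists_rotation (hκ : Function.Injective κ) {x y : N} (h : Unfolds κ L R v t)
    (hx : x ∈ t.labels) (hl : t.labels.Nodup) (hr : RotatesAt κ L R L' R' x y)
    (hz : ∀ z, z ≠ x → z ≠ y → L' z = L z ∧ R' z = R z) :
    ∃ t', RightRotation t.shape t'.shape ∧ t'.labels.Perm t.labels ∧ Unfolds κ L' R' v t' ∧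
      leafList L' R' v t' = leafList L R v t := by
  induction t generalizing v with
  | nil => simp [labels] at hx
  | node d s u ihs ihu =>
    simp only [labels, List.nodup_cons, List.mem_append, not_or, List.nodup_append] at hl
    obtain ⟨⟨hds, hdu⟩, hs, hu, hsu⟩ := hl
    by_cases hdx : d = x
    · subst hdx
      obtain ⟨a, b, rfl⟩ := h.2.1.eq_node hr.left hκ
      obtain ⟨h1, ⟨-, ha, hb⟩, hu'⟩ := h
      simp only [labels, List.nodup_cons, List.mem_append, not_or, List.mem_cons,
        List.nodup_append] at hds hs hsu
      have ha' : ∀ z ∈ a.labels, L' z = L z ∧ R' z = R z := fun z hza =>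
        hz z (by rintro rfl; exact hds.2.1 hza) (by rintro rfl; exact hs.1.1 hza)
      have hb' : ∀ z ∈ b.labels, L' z = L z ∧ R' z = R z := fun z hzb =>
        hz z (by rintro rfl; exact hds.2.2 hzb) (by rintro rfl; exact hs.1.2 hzb)
      have hu'' : ∀ z ∈ u.labels, L' z = L z ∧ R' z = R z := fun z hzu =>
        hz z (by rintro rfl; exact hdu hzu) (by rintro rfl; exact hsu _ (Or.inl rfl) _ hzu rfl)
      refine ⟨.node d a (.node y b u), .root _ _ _, ?_, ⟨h1, ?_, hr.right', ?_, ?_⟩, ?_⟩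
      · simp only [labels, List.perm_cons, List.cons_append, List.append_assoc]
        exact List.perm_middle
      · rw [hr.left_eq]
        exact ha.congr_eq ha'
      · rw [hr.mid_eq]
        exact hb.congr_eq hb'
      · rw [hr.right_eq]
        exact hu'.congr_eq hu''
      · simp only [leafList, hr.left_eq, hr.mid_eq, hr.right_eq, leafList_congr ha',
          leafList_congr hb', leafList_congr hu'', List.append_assoc]
    · simp only [labels, List.mem_cons, Ne.symm hdx, List.mem_append, false_or] at hx
      -- A subtree containing `x` contains its child `y`, so the rotation stays on one side of `d`.
      have hy : ∀ {v} {t : BinaryTree N}, Unfolds κ L R v t → x ∈ t.labels → y ∈ t.labels :=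
        fun ht hxt => (ht.mem_labels_iff hκ).2 (hr.left ▸ left_mem_edgeList hxt)
      rcases hx with hx | hx
      · have hys := hy h.2.1 hx
        have hd := hz d hdx (by rintro rfl; exact hds hys)
        have hu' : ∀ z ∈ u.labels, L' z = L z ∧ R' z = R z := fun z hzu =>
          hz z (by rintro rfl; exact hsu _ hx _ hzu rfl) (by rintro rfl; exact hsu _ hys _ hzu rfl)
        obtain ⟨s', h1, h2, h3, h4⟩ := ihs h.2.1 hx hs
        refine ⟨.node d s' u, .left _ _ _ h1, (h2.append_right _).cons _, ⟨h.1, ?_, ?_⟩, ?_⟩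
        · rwa [hd.1]
        · rw [hd.2]
          exact h.2.2.congr_eq hu'
        · rw [leafList, leafList, hd.1, hd.2, h4, leafList_congr hu']
      · have hyu := hy h.2.2 hx
        have hd := hz d hdx (by rintro rfl; exact hdu hyu)
        have hs' : ∀ z ∈ s.labels, L' z = L z ∧ R' z = R z := fun z hzs =>
          hz z (by rintro rfl; exact hsu _ hzs _ hx rfl) (by rintro rfl; exact hsu _ hzs _ hyu rfl)
        obtain ⟨u', h1, h2, h3, h4⟩ := ihu h.2.2 hx hu
        refine ⟨.node d s u', .right _ _ _ h1, (h2.append_left _).cons _, ⟨h.1, ?_, ?_⟩, ?_⟩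
        · rw [hd.1]
          exact h.2.1.congr_eq hs'
        · rwa [hd.2]
        · rw [leafList, leafList, hd.1, hd.2, h4, leafList_congr hs']

/-- A rotation of the underlying tree is a rotation of a labelled tree. -/
theorem RightRotation.exists_labelled {S S' : BinaryTree Unit} (h : RightRotation S S')
    (t : BinaryTree N) (ht : t.shape = S) :
    ∃ t' : BinaryTree N, t'.shape = S' ∧ t'.labels.Perm t.labels ∧
      ∀ {L R L' R' : N → X} {v v' : X}, Unfolds κ L R v t → Unfolds κ L' R' v' t' →
        leafList L R v t = leafList L' R' v' t' →
        v = v' ∧ ∃ x y, RotatesAt κ L R L' R' x y ∧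
          ∀ z ∈ t.labels, z ≠ x → z ≠ y → L' z = L z ∧ R' z = R z := by
  induction h generalizing t with
  | root A B C =>
    obtain _ | ⟨x, _ | ⟨y, a, b⟩, c⟩ := t
    · simp [shape, BinaryTree.map] at ht
    · simp [shape, BinaryTree.map] at ht
    simp only [shape, BinaryTree.map, node.injEq, true_and] at ht
    obtain ⟨⟨rfl, rfl⟩, rfl⟩ := ht
    refine ⟨.node x a (.node y b c), rfl, ?_, ?_⟩
    · simp only [labels, List.perm_cons, List.cons_append, List.append_assoc]
      exact List.perm_middle
    · intro L R L' R' v v' h h' hf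
      obtain ⟨h1, ⟨h2, ha, hb⟩, hc⟩ := h
      obtain ⟨h1', ha', h2', hb', hc'⟩ := h'
      simp only [leafList, List.append_assoc] at hf
      -- The leaf lists split at the same places, so the subtrees `a`, `b`, `c` have the same root
      -- edges and inner edges in both graphs.
      obtain ⟨fa, hf⟩ := List.append_inj hf (by simp only [length_leafList])
      obtain ⟨fb, fc⟩ := List.append_inj hf (by simp only [length_leafList])
      obtain ⟨ea, ea'⟩ := ha.eq_of_leafList_eq ha' fa
      obtain ⟨eb, eb'⟩ := hb.eq_of_leafList_eq hb' fb
      obtain ⟨ec, ec'⟩ := hc.eq_of_leafList_eq hc' fc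
      refine ⟨h1.trans h1'.symm, x, y, ⟨h2, h2', ea.symm, eb.symm, ec.symm⟩, fun z hz hzx hzy => ?_⟩
      simp only [labels, List.mem_cons, hzx, hzy, List.mem_append, false_or] at hz
      rcases hz with (hz | hz) | hz
      · exact ⟨(ea' z hz).1.symm, (ea' z hz).2.symm⟩
      · exact ⟨(eb' z hz).1.symm, (eb' z hz).2.symm⟩
      · exact ⟨(ec' z hz).1.symm, (ec' z hz).2.symm⟩
  | left A A' B hr ih =>
    obtain _ | ⟨d, s, u⟩ := t
    · simp [shape, BinaryTree.map] at ht
    simp only [shape, BinaryTree.map, node.injEq, true_and] at ht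
    obtain ⟨hs, rfl⟩ := ht
    obtain ⟨s', hs', hp, H⟩ := ih s hs
    refine ⟨.node d s' u, by rw [← hs']; rfl, (hp.append_right _).cons _, ?_⟩
    intro L R L' R' v v' h h' hf
    obtain ⟨f1, f2⟩ := List.append_inj hf
      (by rw [length_leafList, length_leafList, ← length_labels, ← length_labels, hp.length_eq])
    obtain ⟨e1, x, y, hxy, hz⟩ := H h.2.1 h'.2.1 f1
    obtain ⟨e2, e3⟩ := h.2.2.eq_of_leafList_eq h'.2.2 f2
    refine ⟨h.1.trans h'.1.symm, x, y, hxy, fun z hzl hzx hzy => ?_⟩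
    simp only [labels, List.mem_cons, List.mem_append] at hzl
    rcases hzl with rfl | hzl | hzl
    · exact ⟨e1.symm, e2.symm⟩
    · exact hz z hzl hzx hzy
    · exact ⟨(e3 z hzl).1.symm, (e3 z hzl).2.symm⟩
  | right A B B' hr ih =>
    obtain _ | ⟨d, s, u⟩ := t
    · simp [shape, BinaryTree.map] at ht
    simp only [shape, BinaryTree.map, node.injEq, true_and] at ht
    obtain ⟨rfl, hu⟩ := ht
    obtain ⟨u', hu', hp, H⟩ := ih u hu
    refine ⟨.node d s u', by rw [← hu']; rfl, (hp.append_left _).cons _, ?_⟩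
    intro L R L' R' v v' h h' hf
    obtain ⟨f1, f2⟩ := List.append_inj hf (by simp only [length_leafList])
    obtain ⟨e1, x, y, hxy, hz⟩ := H h.2.2 h'.2.2 f2
    obtain ⟨e2, e3⟩ := h.2.1.eq_of_leafList_eq h'.2.1 f1
    refine ⟨h.1.trans h'.1.symm, x, y, hxy, fun z hzl hzx hzy => ?_⟩
    simp only [labels, List.mem_cons, List.mem_append] at hzl
    rcases hzl with rfl | hzl | hzl
    · exact ⟨e2.symm, e1.symm⟩
    · exact ⟨(e3 z hzl).1.symm, (e3 z hzl).2.symm⟩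
    · exact hz z hzl hzx hzy

/-! #### Contours -/

/-- `U` and `V` are constant along the contour of an unfolded tree: here `U e` and `V e` stand for
the two sides of the edge `e`. -/
structure IsContour (κ L R : N → X) {F : Type} (U V : X → F) (c : N) : Prop where
  right : U (κ c) = U (R c)
  left : V (L c) = V (κ c)
  mid : V (R c) = U (L c)

variable {F : Type} {U V : X → F}

/-- Walk round the tree from the left side `V` of the root to its right side `U`. The right side of
each leaf continues as the left side of the next leaf, and the right side of the last leaf as that
of the root. -/
theorem Unfolds.map_leafList (h : Unfolds κ L R v t) (hc : ∀ c ∈ t.labels, IsContour κ L R U V c) :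
    (leafList L R v t).map V ++ [U v] = V v :: (leafList L R v t).map U := by
  induction t generalizing v with
  | nil => rfl
  | node c s u ihs ihu =>
    simp only [labels, List.mem_cons, List.mem_append] at hc
    have h1 := ihs h.2.1 fun z hz => hc z (by simp [hz])
    have h2 := ihu h.2.2 fun z hz => hc z (by simp [hz])
    have h3 := hc c (Or.inl rfl)
    rw [← h3.right, h3.mid] at h2
    rw [h3.left] at h1
    rw [h.1, leafList, List.map_append, List.map_append, List.append_assoc, h2, ← List.cons_append,
      ← h1, List.append_assoc, List.singleton_append]

/-- Each side of each edge lies on the contour piece of a leaf or of the root. -/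
theorem Unfolds.exists_mem_leafList (h : Unfolds κ L R v t)
    (hc : ∀ c ∈ t.labels, IsContour κ L R U V c) {x : X} (hx : x ∈ edgeList L R v t) :
    (U x = V v ∨ ∃ y ∈ leafList L R v t, U x = U y) ∧
      (V x = V v ∨ ∃ y ∈ leafList L R v t, V x = U y) := by
  induction t generalizing v x with
  | nil =>
    simp only [edgeList, labels, List.flatMap_nil, List.mem_singleton] at hx
    subst hx
    exact ⟨Or.inr ⟨x, by simp [leafList], rfl⟩, Or.inl rfl⟩
  | node c s u ihs ihu =>
    simp only [labels, List.mem_cons, List.mem_append] at hc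
    have h3 := hc c (Or.inl rfl)
    have hs : ∀ z, (z = V (L c) ∨ ∃ y ∈ leafList L R (L c) s, z = U y) →
        (z = V v ∨ ∃ y ∈ leafList L R v (.node c s u), z = U y) := by
      rintro z (hz | ⟨y, hy, hz⟩)
      · exact Or.inl (by rw [hz, h3.left, h.1])
      · exact Or.inr ⟨y, List.mem_append_left _ hy, hz⟩
    have hs' := @ihs (L c) h.2.1 fun z hz => hc z (by simp [hz])
    have hu : ∀ z, (z = V (R c) ∨ ∃ y ∈ leafList L R (R c) u, z = U y) →
        (z = V v ∨ ∃ y ∈ leafList L R v (.node c s u), z = U y) := by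
      rintro z (hz | ⟨y, hy, hz⟩)
      · rw [hz, h3.mid]
        exact hs _ (hs' self_mem_edgeList).1
      · exact Or.inr ⟨y, List.mem_append_right _ hy, hz⟩
    have hu' := @ihu (R c) h.2.2 fun z hz => hc z (by simp [hz])
    rcases mem_edgeList_node.1 hx with rfl | hx | hx
    · refine ⟨?_, Or.inl rfl⟩
      have h4 := hu _ (hu' self_mem_edgeList).1
      rwa [← h3.right, ← h.1] at h4
    · exact ⟨hs _ (hs' hx).1, hs _ (hs' hx).2⟩
    · exact ⟨hu _ (hu' hx).1, hu _ (hu' hx).2⟩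

/-- The contour pieces of a tree can be numbered from left to right. -/
theorem Unfolds.exists_contour (h : Unfolds κ L R v t) (hn : (edgeList L R v t).Nodup) (a : ℕ) :
    ∃ U V : X → ℕ, (∀ c ∈ t.labels, IsContour κ L R U V c) ∧ V v = a ∧
      U v = a + (t.numNodes + 1) ∧
      (leafList L R v t).map V = List.range' a (t.numNodes + 1) := by
  classical
  induction t generalizing v a with
  | nil => exact ⟨fun _ => a + 1, fun _ => a, by simp [labels], rfl, rfl, rfl⟩
  | node c s u ihs ihu =>
    rw [(edgeList_node_perm c s u).nodup_iff, List.nodup_cons, List.mem_append, not_or,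
      List.nodup_append] at hn
    obtain ⟨⟨hvs, hvu⟩, hns, hnu, hsu⟩ := hn
    obtain ⟨U₁, V₁, c₁, hV₁, hU₁, hf₁⟩ := ihs h.2.1 hns a
    -- The numbering of the right subtree starts with the number at which that of the left subtree
    -- ends, since they share the contour piece between them.
    obtain ⟨U₂, V₂, c₂, hV₂, hU₂, hf₂⟩ := ihu h.2.2 hnu (a + (s.numNodes + 1))
    let E₁ := edgeList L R (L c) s
    let E₂ := edgeList L R (R c) u
    -- The edge sets of the two subtrees are disjoint and omit `v`, so the numberings can be pasted;
    -- the last value is the one for `v`.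
    let U : X → ℕ := fun x => if x ∈ E₁ then U₁ x else if x ∈ E₂ then U₂ x else
      a + (s.numNodes + u.numNodes + 1 + 1)
    let V : X → ℕ := fun x => if x ∈ E₁ then V₁ x else if x ∈ E₂ then V₂ x else a
    have i₁ : ∀ x ∈ E₁, U x = U₁ x ∧ V x = V₁ x := fun x hx => by simp [U, V, hx]
    have i₂ : ∀ x ∈ E₂, U x = U₂ x ∧ V x = V₂ x := fun x hx => by
      have : x ∉ E₁ := fun hx' => hsu x hx' x hx rfl
      simp [U, V, hx, this]
    have i₀ : U v = a + (s.numNodes + u.numNodes + 1 + 1) ∧ V v = a := by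
      simp [U, V, E₁, E₂, hvs, hvu]
    have j₁ := i₁ _ (self_mem_edgeList (v := L c))
    have j₂ := i₂ _ (self_mem_edgeList (v := R c))
    refine ⟨U, V, fun d hd => ?_, i₀.2, i₀.1, ?_⟩
    · simp only [labels, List.mem_cons, List.mem_append] at hd
      rcases hd with rfl | hd | hd
      · refine ⟨?_, ?_, ?_⟩
        · rw [← h.1, i₀.1, j₂.1, hU₂]
          omega
        · rw [← h.1, i₀.2, j₁.2, hV₁]
        · rw [j₂.2, j₁.1, hV₂, hU₁]
      · have k1 := i₁ _ (left_mem_edgeList hd)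
        have k2 := i₁ _ (right_mem_edgeList hd)
        have k3 := i₁ (κ d) (h.2.1.edgeList_perm.mem_iff.2
          (List.mem_append_left _ (List.mem_map_of_mem hd)))
        have k := c₁ d hd
        exact ⟨by rw [k3.1, k2.1, k.right], by rw [k1.2, k3.2, k.left], by rw [k2.2, k1.1, k.mid]⟩
      · have k1 := i₂ _ (left_mem_edgeList hd)
        have k2 := i₂ _ (right_mem_edgeList hd)
        have k3 := i₂ (κ d) (h.2.2.edgeList_perm.mem_iff.2
          (List.mem_append_left _ (List.mem_map_of_mem hd)))
        have k := c₂ d hd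
        exact ⟨by rw [k3.1, k2.1, k.right], by rw [k1.2, k3.2, k.left], by rw [k2.2, k1.1, k.mid]⟩
    · rw [leafList, List.map_append,
        List.map_congr_left fun x hx => (i₁ x (h.2.1.mem_edgeList_of_mem_leafList hx)).2,
        List.map_congr_left fun x hx => (i₂ x (h.2.2.mem_edgeList_of_mem_leafList hx)).2, hf₁, hf₂,
        numNodes, List.range'_append_1]
      congr 1
      omega

end Unfolding

/-! ### Prographs and pairs of labelled trees -/

section Realizes

variable {C P : Type}

theorem OutPort.prod_injective : Function.Injective (OutPort.prod : P → OutPort C P) :=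
  fun _ _ h => OutPort.prod.inj h

theorem InPort.cop_injective : Function.Injective (InPort.cop : C → InPort C P) :=
  fun _ _ h => InPort.cop.inj h

/-- Following the edge `v` upwards through coproducts one reads the mirror image of `s`. -/
abbrev CopUnfolds (w : OutPort C P ≃ InPort C P) (v : InPort C P) (s : BinaryTree C) : Prop :=
  Unfolds InPort.cop (fun c => w (.copR c)) (fun c => w (.copL c)) v s

/-- Following the edge `v` downwards through products one reads `t`. -/
abbrev ProdUnfolds (w : OutPort C P ≃ InPort C P) (v : OutPort C P) (t : BinaryTree P) : Prop :=
  Unfolds OutPort.prod (fun p => w.symm (.prodL p)) (fun p => w.symm (.prodR p)) v t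

/-- The leaves of a tree of coproducts, from right to left. -/
abbrev copLeaves (w : OutPort C P ≃ InPort C P) (v : InPort C P) (s : BinaryTree C) :
    List (InPort C P) :=
  leafList (fun c => w (.copR c)) (fun c => w (.copL c)) v s

/-- The leaves of a tree of products, from left to right. -/
abbrev prodLeaves (w : OutPort C P ≃ InPort C P) (v : OutPort C P) (t : BinaryTree P) :
    List (OutPort C P) :=
  leafList (fun p => w.symm (.prodL p)) (fun p => w.symm (.prodR p)) v t

/-- The coproducts form the mirror image of the tree `s`, and the products form the tree `t`. -/
structure SplitsInto (w : OutPort C P ≃ InPort C P) (p₀ : P) (c₀ : C) (s : BinaryTree C)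
    (t : BinaryTree P) : Prop where
  closing : w (.prod p₀) = .cop c₀
  cop : CopUnfolds w (.cop c₀) s
  prod : ProdUnfolds w (.prod p₀) t
  cop_nodup : s.labels.Nodup
  cop_mem : ∀ c, c ∈ s.labels
  prod_nodup : t.labels.Nodup
  prod_mem : ∀ p, p ∈ t.labels

/-- The edges `w` are those of the gluing of the mirror image of `s` with `t`. -/
structure Realizes (w : OutPort C P ≃ InPort C P) (p₀ : P) (c₀ : C) (s : BinaryTree C)
    (t : BinaryTree P) : Prop extends SplitsInto w p₀ c₀ s t where
  glue : (prodLeaves w (.prod p₀) t).map w = (copLeaves w (.cop c₀) s).reverse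

variable {w w' : OutPort C P ≃ InPort C P} {p₀ p₀' : P} {c₀ c₀' : C} {s : BinaryTree C}
  {t : BinaryTree P}

theorem copBranching (h : w (.prod p₀) = .cop c₀) :
    Branching (InPort.cop (P := P)) (fun c => w (.copR c)) (fun c => w (.copL c)) (.cop c₀) where
  inj := InPort.cop_injective
  left_inj c d h := by simpa using h
  right_inj c d h := by simpa using h
  left_ne_right c d h := by simp at h
  root_ne_left c h' := by simp [← h] at h'
  root_ne_right c h' := by simp [← h] at h'

theorem prodBranching (h : w (.prod p₀) = .cop c₀) :
    Branching (OutPort.prod (C := C)) (fun p => w.symm (.prodL p)) (fun p => w.symm (.prodR p))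
      (.prod p₀) where
  inj := OutPort.prod_injective
  left_inj c d h := by simpa using h
  right_inj c d h := by simpa using h
  left_ne_right c d h := by simp at h
  root_ne_left c h' := by simp [Equiv.eq_symm_apply, h] at h'
  root_ne_right c h' := by simp [Equiv.eq_symm_apply, h] at h'

theorem copLeaves_eq_map (h : w (.prod p₀) = .cop c₀) (s : BinaryTree C) :
    copLeaves w (.cop c₀) s =
      (leafList OutPort.copR OutPort.copL (.prod p₀ : OutPort C P) s).map w := by
  rw [← leafList_comp, h]
  rfl

theorem prodLeaves_eq_map (h : w (.prod p₀) = .cop c₀) (t : BinaryTree P) :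
    prodLeaves w (.prod p₀) t =
      (leafList InPort.prodL InPort.prodR (.cop c₀ : InPort C P) t).map w.symm := by
  rw [← leafList_comp, ← h, Equiv.symm_apply_apply]
  rfl

/-- The leaf edges, named by the inputs they enter, are read off from the product tree without
reference to `w`. This makes two wirings with the same trees comparable. -/
theorem Realizes.copLeaves_eq (h : Realizes w p₀ c₀ s t) :
    copLeaves w (.cop c₀) s =
      (leafList InPort.prodL InPort.prodR (.cop c₀ : InPort C P) t).reverse := by
  have h1 := h.glue
  rw [prodLeaves_eq_map h.closing, List.map_map, Equiv.self_comp_symm, List.map_id] at h1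
  rw [h1, List.reverse_reverse]

theorem Realizes.prodLeaves_eq (h : Realizes w p₀ c₀ s t) :
    prodLeaves w (.prod p₀) t =
      (leafList OutPort.copR OutPort.copL (.prod p₀ : OutPort C P) s).reverse := by
  have h1 := h.glue
  rw [copLeaves_eq_map h.closing, ← List.map_reverse] at h1
  exact (List.map_injective_iff.2 w.injective) h1

theorem SplitsInto.numNodes_cop [Finite C] (h : SplitsInto w p₀ c₀ s t) :
    s.numNodes = Nat.card C := by
  classical
  have := Fintype.ofFinite C
  rw [← length_labels, Nat.card_eq_fintype_card, ← List.toFinset_card_of_nodup h.cop_nodup,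
    ← Finset.card_univ]
  congr 1
  ext c
  simp [h.cop_mem c]

theorem SplitsInto.numNodes_prod [Finite P] (h : SplitsInto w p₀ c₀ s t) :
    t.numNodes = Nat.card P := by
  classical
  have := Fintype.ofFinite P
  rw [← length_labels, Nat.card_eq_fintype_card, ← List.toFinset_card_of_nodup h.prod_nodup,
    ← Finset.card_univ]
  congr 1
  ext c
  simp [h.prod_mem c]

/-- The input of a coproduct other than the root is joined to an output of a coproduct. -/
theorem SplitsInto.eq_root_or (h : SplitsInto w p₀ c₀ s t) (c : C) :
    c = c₀ ∨ ∃ d, w (.copL d) = .cop c ∨ w (.copR d) = .cop c := by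
  have h1 := (h.cop.mem_labels_iff InPort.cop_injective).1 (h.cop_mem c)
  simp only [edgeList, List.mem_cons, List.mem_flatMap, List.not_mem_nil, or_false,
    InPort.cop.injEq] at h1
  rcases h1 with h1 | ⟨d, -, h1 | h1⟩
  · exact Or.inl h1
  · exact Or.inr ⟨d, Or.inr h1.symm⟩
  · exact Or.inr ⟨d, Or.inl h1.symm⟩

/-- Every coproduct input is already taken by the closing edge or by an output of a coproduct. -/
theorem SplitsInto.prod_ne_cop (h : SplitsInto w p₀ c₀ s t) {p : P} (hp : p ≠ p₀) (c : C) :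
    w (.prod p) ≠ .cop c := by
  intro hc
  rcases h.eq_root_or c with rfl | ⟨d, hd | hd⟩
  · rw [← h.closing] at hc
    simp [hp] at hc
  · simp [← hc] at hd
  · simp [← hc] at hd

theorem SplitsInto.prod_eq (h : SplitsInto w p₀ c₀ s t) {p : P} (hp : p ≠ p₀) :
    ∃ q, w (.prod p) = .prodL q ∨ w (.prod p) = .prodR q := by
  have := h.prod_ne_cop hp
  cases hw : w (.prod p) with
  | cop c => exact absurd hw (this c)
  | prodL q => exact ⟨q, Or.inl rfl⟩
  | prodR q => exact ⟨q, Or.inr rfl⟩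

/-- The two labelled trees determine the edges. -/
theorem Realizes.unique (h : Realizes w p₀ c₀ s t) (h' : Realizes w' p₀' c₀' s t) :
    p₀ = p₀' ∧ c₀ = c₀' ∧ w = w' := by
  obtain rfl : p₀ = p₀' := OutPort.prod.inj ((h.prod.root_iff h'.prod p₀).1 rfl).symm
  obtain rfl : c₀ = c₀' := InPort.cop.inj ((h.cop.root_iff h'.cop c₀).1 rfl).symm
  refine ⟨rfl, rfl, ?_⟩
  have h1 := (h.cop.eq_of_leafList_eq h'.cop (by
    have e := h.copLeaves_eq
    rwa [← h'.copLeaves_eq] at e)).2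
  have h2 := (h.prod.eq_of_leafList_eq h'.prod (by
    have e := h.prodLeaves_eq
    rwa [← h'.prodLeaves_eq] at e)).2
  have h3 : w.symm = w'.symm := by
    ext i
    cases i with
    | cop c =>
      rcases h.eq_root_or c with rfl | ⟨d, hd | hd⟩
      · rw [← h.closing, Equiv.symm_apply_apply, h.closing, ← h'.closing, Equiv.symm_apply_apply]
      · rw [← hd, Equiv.symm_apply_apply, (h1 d (h.cop_mem d)).2, Equiv.symm_apply_apply]
      · rw [← hd, Equiv.symm_apply_apply, (h1 d (h.cop_mem d)).1, Equiv.symm_apply_apply]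
    | prodL p => exact (h2 p (h.prod_mem p)).1
    | prodR p => exact (h2 p (h.prod_mem p)).2
  rw [← w.symm_symm, h3, w'.symm_symm]

/-! ### Renaming of the operators -/

section Map

variable {C' P' : Type}

/-- Renaming the operators, as a bijection of the outputs. -/
def OutPort.mapEquiv (f : C ≃ C') (g : P ≃ P') : OutPort C P ≃ OutPort C' P' where
  toFun := OutPort.map f g
  invFun := OutPort.map f.symm g.symm
  left_inv o := by cases o <;> simp [OutPort.map]
  right_inv o := by cases o <;> simp [OutPort.map]

/-- Renaming the operators, as a bijection of the inputs. -/
def InPort.mapEquiv (f : C ≃ C') (g : P ≃ P') : InPort C P ≃ InPort C' P' where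
  toFun := InPort.map f g
  invFun := InPort.map f.symm g.symm
  left_inv o := by cases o <;> simp [InPort.map]
  right_inv o := by cases o <;> simp [InPort.map]

theorem Realizes.map (h : Realizes w p₀ c₀ s t) (f : C ≃ C') (g : P ≃ P')
    {u : OutPort C' P' ≃ InPort C' P'} (hu : ∀ o, u (o.map f g) = (w o).map f g) :
    Realizes u (g p₀) (f c₀) (s.map f) (t.map g) := by
  have hu' : ∀ i, u.symm (i.map f g) = (w.symm i).map f g := fun i => by
    rw [Equiv.symm_apply_eq, hu, Equiv.apply_symm_apply]
  have hR : ∀ c, u (.copR (f c)) = (w (.copR c)).map f g := fun c => hu (.copR c)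
  have hL : ∀ c, u (.copL (f c)) = (w (.copL c)).map f g := fun c => hu (.copL c)
  have hR' : ∀ p, u.symm (.prodR (g p)) = (w.symm (.prodR p)).map f g := fun p => hu' (.prodR p)
  have hL' : ∀ p, u.symm (.prodL (g p)) = (w.symm (.prodL p)).map f g := fun p => hu' (.prodL p)
  refine ⟨⟨?_, ?_, ?_, ?_, ?_, ?_, ?_⟩, ?_⟩
  · have := hu (.prod p₀)
    rwa [h.closing] at this
  · refine h.cop.map (ξ := InPort.map f g) (fun _ => rfl) (fun x hx c hc => ?_) hR hL
    cases x with
    | cop d => exact hx d rfl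
    | prodL p => simp [InPort.map] at hc
    | prodR p => simp [InPort.map] at hc
  · refine h.prod.map (ξ := OutPort.map f g) (fun _ => rfl) (fun x hx c hc => ?_) hL' hR'
    cases x with
    | prod d => exact hx d rfl
    | copL p => simp [OutPort.map] at hc
    | copR p => simp [OutPort.map] at hc
  · rw [labels_map]
    exact h.cop_nodup.map f.injective
  · intro c
    rw [labels_map]
    exact List.mem_map.2 ⟨f.symm c, h.cop_mem _, by simp⟩
  · rw [labels_map]
    exact h.prod_nodup.map g.injective
  · intro c
    rw [labels_map]
    exact List.mem_map.2 ⟨g.symm c, h.prod_mem _, by simp⟩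
  · have e1 := leafList_map (ξ := InPort.map f g) (f := f) (l := fun c => u (.copR c))
      (r := fun c => u (.copL c)) (L := fun c => w (.copR c)) (R := fun c => w (.copL c)) hR hL
      (.cop c₀) s
    have e2 := leafList_map (ξ := OutPort.map f g) (f := g) (l := fun p => u.symm (.prodL p))
      (r := fun p => u.symm (.prodR p)) (L := fun p => w.symm (.prodL p))
      (R := fun p => w.symm (.prodR p)) hL' hR' (.prod p₀) t
    simp only [InPort.map, OutPort.map] at e1 e2
    rw [prodLeaves, e2, copLeaves, e1, ← List.map_reverse, ← h.glue, List.map_map, List.map_map]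
    exact List.map_congr_left fun o _ => hu o

end Map

end Realizes

namespace LabelledPrograph

variable {C P C' P' : Type}

/-- The prograph is the gluing of the mirror image of `s` with `t`. -/
def RealizedBy (G : LabelledPrograph C P) (s : BinaryTree C) (t : BinaryTree P) : Prop :=
  Realizes G.wire G.north G.south s t

variable {G : LabelledPrograph C P} {H : LabelledPrograph C' P'} {s : BinaryTree C}
  {t : BinaryTree P}

theorem Iso.map_south {f : C ≃ C'} {g : P ≃ P'} (hg : g G.north = H.north)
    (h : ∀ o : OutPort C P, H.wire (o.map f g) = (G.wire o).map f g) : f G.south = H.south := by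
  have h1 := h (.prod G.north)
  rw [G.closing, OutPort.map, hg, H.closing] at h1
  exact (InPort.cop.inj h1).symm

theorem RealizedBy.exists_of_iso (h : G.RealizedBy s t) (hi : G.Iso H) :
    ∃ s' t', H.RealizedBy s' t' ∧ s'.shape = s.shape ∧ t'.shape = t.shape := by
  obtain ⟨f, g, hg, hw⟩ := hi
  refine ⟨s.map f, t.map g, ?_, shape_map _ _, shape_map _ _⟩
  have := Realizes.map h f g hw
  rwa [hg, Iso.map_south hg hw] at this

/-- Equal shapes give bijections of the labels. The wiring of `G` transported along them realizes
the same labelled trees as that of `H`, so the two coincide. -/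
theorem RealizedBy.iso (h : G.RealizedBy s t) {s' : BinaryTree C'} {t' : BinaryTree P'}
    (h' : H.RealizedBy s' t') (hs : s.shape = s'.shape) (ht : t.shape = t'.shape) : G.Iso H := by
  obtain ⟨f, rfl⟩ := exists_equiv_map_eq hs h.cop_nodup h.cop_mem h'.cop_nodup h'.cop_mem
  obtain ⟨g, rfl⟩ := exists_equiv_map_eq ht h.prod_nodup h.prod_mem h'.prod_nodup h'.prod_mem
  let u := (OutPort.mapEquiv f g).symm.trans (G.wire.trans (InPort.mapEquiv f g))
  have hu : ∀ o, u (o.map f g) = (G.wire o).map f g := fun o => by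
    have : (OutPort.mapEquiv f g).symm (o.map f g) = o :=
      (OutPort.mapEquiv f g).symm_apply_apply o
    simp only [u, Equiv.trans_apply, this]
    rfl
  obtain ⟨h1, -, h2⟩ := (Realizes.map h f g hu).unique h'
  exact ⟨f, g, h1, fun o => by rw [← hu, h2]⟩

theorem RealizedBy.not_hasProdCopEdge (h : G.RealizedBy s t) : ¬ G.HasProdCopEdge := by
  rintro ⟨p, c, hp, hc⟩
  exact h.prod_ne_cop hp c hc

/-! #### Rotations -/

variable {G H : LabelledPrograph C P}

theorem south_eq_of_wire_eq (hn : H.north = G.north)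
    (h : H.wire (.prod G.north) = G.wire (.prod G.north)) : H.south = G.south := by
  have h1 := H.closing
  rw [hn, h, G.closing] at h1
  exact (InPort.cop.inj h1).symm

theorem south_eq_of_wire_symm_eq (h : H.wire.symm (.cop H.south) = G.wire.symm (.cop H.south))
    (hn : H.north = G.north) : H.south = G.south := by
  rw [← H.closing, Equiv.symm_apply_apply, Equiv.eq_symm_apply, hn, G.closing, ← hn, H.closing] at h
  exact (InPort.cop.inj h).symm

/-- In `s` the right output is the left edge, so rotation (a) is a right rotation of `s`. Product
outputs are untouched, so the product tree keeps its inner edges and only its leaf edges get new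
names. -/
theorem RealizedBy.exists_of_copRotation (h : G.RealizedBy s t) (hr : G.CopRotation H) :
    ∃ s' : BinaryTree C, RightRotation s.shape s'.shape ∧ H.RealizedBy s' t := by
  obtain ⟨hn, x, y, h1, h2, h3, h4, h5, h6, h7⟩ := hr
  have hs := south_eq_of_wire_eq hn (h7 _)
  obtain ⟨s', e1, e2, e3, e4⟩ := h.cop.exists_rotation
    (L' := fun c => H.wire (.copR c)) (R' := fun c => H.wire (.copL c))
    InPort.cop_injective (h.cop_mem x) h.cop_nodup ⟨h1, h2, h5, h4, h3⟩
    fun z hzx hzy => (h6 z hzx hzy).symm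
  have hsymm : ∀ i p, G.wire.symm i = .prod p ↔ H.wire.symm i = .prod p := fun i p => by
    rw [Equiv.symm_apply_eq, Equiv.symm_apply_eq, h7]
  refine ⟨s', e1, ⟨⟨H.closing, ?_, ?_, e2.nodup_iff.2 h.cop_nodup,
    fun c => e2.mem_iff.2 (h.cop_mem c), h.prod_nodup, h.prod_mem⟩, ?_⟩⟩
  · rwa [hs]
  · rw [hn]
    exact h.prod.congr (fun _ => Iff.rfl) fun z _ c => ⟨hsymm _ _, hsymm _ _⟩
  · rw [prodLeaves_eq_map H.closing, List.map_map, Equiv.self_comp_symm, List.map_id, hs, copLeaves,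
      e4]
    exact (List.reverse_eq_iff.2 h.copLeaves_eq).symm

theorem RealizedBy.exists_of_prodRotation (h : G.RealizedBy s t) (hr : G.ProdRotation H) :
    ∃ t' : BinaryTree P, RightRotation t.shape t'.shape ∧ H.RealizedBy s t' := by
  obtain ⟨hn, x, y, h1, h2, h3, h4, h5, h6, h7⟩ := hr
  have hs := south_eq_of_wire_symm_eq (h7 _) hn
  obtain ⟨t', e1, e2, e3, e4⟩ := h.prod.exists_rotation
    (L' := fun p => H.wire.symm (.prodL p)) (R' := fun p => H.wire.symm (.prodR p))
    OutPort.prod_injective (h.prod_mem x) h.prod_nodup ⟨h1, h2, h3, h4, h5⟩ h6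
  have hw : ∀ o c, G.wire o = .cop c ↔ H.wire o = .cop c := fun o c => by
    rw [← Equiv.eq_symm_apply, ← Equiv.eq_symm_apply, h7]
  refine ⟨t', e1, ⟨⟨H.closing, ?_, ?_, h.cop_nodup, h.cop_mem, e2.nodup_iff.2 h.prod_nodup,
    fun c => e2.mem_iff.2 (h.prod_mem c)⟩, ?_⟩⟩
  · rw [hs]
    exact h.cop.congr (fun _ => Iff.rfl) fun z _ c => ⟨hw _ _, hw _ _⟩
  · rwa [hn]
  · rw [copLeaves_eq_map H.closing, hn, prodLeaves, e4, ← List.map_reverse]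
    exact congrArg _ h.prodLeaves_eq

/-- Take any prograph realizing the rotated labelled tree with the same `t`. Its coproduct leaves
are the same, and so `RightRotation.exists_labelled` shows that it differs from `G` by a rotation
only. -/
theorem RealizedBy.exists_copRotation (h : G.RealizedBy s t) {S' : BinaryTree Unit}
    (hr : RightRotation s.shape S')
    (hex : ∀ s' : BinaryTree C, s'.shape = S' → s'.labels.Nodup → (∀ c, c ∈ s'.labels) →
      ∃ H : LabelledPrograph C P, H.RealizedBy s' t) :
    ∃ (H : LabelledPrograph C P) (s' : BinaryTree C), s'.shape = S' ∧ H.RealizedBy s' t ∧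
      G.CopRotation H := by
  obtain ⟨s', e1, e2, e3⟩ := hr.exists_labelled (X := InPort C P) (κ := InPort.cop) s rfl
  obtain ⟨H, hH⟩ := hex s' e1 (e2.nodup_iff.2 h.cop_nodup) fun c => e2.mem_iff.2 (h.cop_mem c)
  have hn : H.north = G.north := OutPort.prod.inj ((h.prod.root_iff hH.prod G.north).1 rfl)
  obtain ⟨hs, x, y, hxy, hz⟩ := e3 h.cop hH.cop (by
    -- The leaves of a nonempty tree do not depend on the root edge, so the lists agree before the
    -- two `south` coproducts are identified.
    obtain ⟨a, b, rfl⟩ := h.prod.eq_node rfl OutPort.prod_injective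
    exact h.copLeaves_eq.trans hH.copLeaves_eq.symm)
  have hp : ∀ p, H.wire (.prod p) = G.wire (.prod p) := fun p => by
    by_cases hpn : p = G.north
    · rw [hpn, G.closing, hs, ← hn, H.closing]
    · obtain ⟨q, hq | hq⟩ := h.prod_eq hpn
      · have := (h.prod.inner_iff hH.prod (h.prod_mem q) p).1.1 (by rw [← hq]; simp)
        rw [hq, ← this, Equiv.apply_symm_apply]
      · have := (h.prod.inner_iff hH.prod (h.prod_mem q) p).2.1 (by rw [← hq]; simp)
        rw [hq, ← this, Equiv.apply_symm_apply]
  exact ⟨H, s', e1, hH, hn, x, y, hxy.left, hxy.right', hxy.right_eq, hxy.mid_eq, hxy.left_eq,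
    fun z hzx hzy => (hz z (h.cop_mem z) hzx hzy).symm, hp⟩

theorem RealizedBy.exists_prodRotation (h : G.RealizedBy s t) {T' : BinaryTree Unit}
    (hr : RightRotation t.shape T')
    (hex : ∀ t' : BinaryTree P, t'.shape = T' → t'.labels.Nodup → (∀ p, p ∈ t'.labels) →
      ∃ H : LabelledPrograph C P, H.RealizedBy s t') :
    ∃ (H : LabelledPrograph C P) (t' : BinaryTree P), t'.shape = T' ∧ H.RealizedBy s t' ∧
      G.ProdRotation H := by
  obtain ⟨t', e1, e2, e3⟩ := hr.exists_labelled (X := OutPort C P) (κ := OutPort.prod) t rfl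
  obtain ⟨H, hH⟩ := hex t' e1 (e2.nodup_iff.2 h.prod_nodup) fun c => e2.mem_iff.2 (h.prod_mem c)
  have hs : H.south = G.south := InPort.cop.inj ((h.cop.root_iff hH.cop G.south).1 rfl)
  obtain ⟨hn, x, y, hxy, hz⟩ := e3 h.prod hH.prod (by
    obtain ⟨a, b, rfl⟩ := h.cop.eq_node rfl InPort.cop_injective
    exact h.prodLeaves_eq.trans hH.prodLeaves_eq.symm)
  have hn' : H.north = G.north := (OutPort.prod.inj hn).symm
  have hc : ∀ c, H.wire.symm (.cop c) = G.wire.symm (.cop c) := fun c => by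
    rcases h.eq_root_or c with rfl | ⟨d, hd | hd⟩
    · rw [← G.closing, Equiv.symm_apply_apply, G.closing, ← hs, ← H.closing,
        Equiv.symm_apply_apply, hn']
    · have := (h.cop.inner_iff hH.cop (h.cop_mem d) c).2.1 hd
      rw [← hd, Equiv.symm_apply_apply, hd, ← this, Equiv.symm_apply_apply]
    · have := (h.cop.inner_iff hH.cop (h.cop_mem d) c).1.1 hd
      rw [← hd, Equiv.symm_apply_apply, hd, ← this, Equiv.symm_apply_apply]
  exact ⟨H, t', e1, hH, hn', x, y, hxy.left, hxy.right', hxy.left_eq, hxy.mid_eq, hxy.right_eq,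
    fun z hzx hzy => hz z (h.prod_mem z) hzx hzy, hc⟩

end LabelledPrograph

/-! ### Faces -/

theorem List.nodup_iff_card_eq_length {α : Type} {l : List α} (h : ∀ a, a ∈ l) :
    l.Nodup ↔ Nat.card α = l.length := by
  classical
  have hf : Fintype α := ⟨l.toFinset, fun a => List.mem_toFinset.2 (h a)⟩
  have hu : (l : Multiset α).toFinset = Finset.univ := by
    ext a
    simp [h a]
  rw [Nat.card_eq_fintype_card, ← Finset.card_univ, ← hu, ← Multiset.coe_card,
    Multiset.toFinset_card_eq_card_iff_nodup, Multiset.coe_nodup]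

/-- Two lists agree if each is the orbit of `a` under the successor function `x ↦ V⁻¹ (U x)`. -/
theorem List.eq_of_map_append_eq_cons {A F : Type} {U V : A → F} {D : Set A}
    (hV : Set.InjOn V D) {K M : List A} (hl : K.length = M.length) (hK : ∀ x ∈ K, x ∈ D)
    (hM : ∀ x ∈ M, x ∈ D) {a b : F} (eK : K.map V ++ [b] = a :: K.map U)
    (eM : M.map V ++ [b] = a :: M.map U) : K = M := by
  induction K generalizing M a with
  | nil => exact (List.eq_nil_of_length_eq_zero hl.symm).symm
  | cons k K ih =>
    cases M with
    | nil => simp at hl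
    | cons m M =>
      simp only [List.map_cons, List.cons_append, List.cons.injEq] at eK eM
      simp only [List.mem_cons, forall_eq_or_imp] at hK hM
      obtain rfl : k = m := hV hK.1 hM.1 (eK.1.trans eM.1.symm)
      rw [ih (by simpa using hl) hK.2 hM.2 eK.2 eM.2]

section Faces

variable {C P : Type} {w : OutPort C P ≃ InPort C P} {p₀ : P} {c₀ : C} {s : BinaryTree C}
  {t : BinaryTree P} {F : Type}

/-- The three corners at a coproduct give the three contour equations. The sides `U` and `V` of an
edge are recorded by its two half-edges, with roles opposite to those in `isContour_prod`; hence the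
contours of `s` and `t` run in opposite directions. -/
theorem isContour_cop {f : Dart C P → F} (hf : ∀ x, f (dartRotation C P (edgeFlip w x)) = f x)
    (c : C) : IsContour InPort.cop (fun c => w (.copR c)) (fun c => w (.copL c))
      (fun i => f (.inr i)) (fun i => f (.inl (w.symm i))) c where
  right := by simpa [edgeFlip, dartRotation] using hf (.inr (w (.copL c)))
  left := by simpa [edgeFlip, dartRotation] using hf (.inl (w.symm (.cop c)))
  mid := by simpa [edgeFlip, dartRotation] using hf (.inr (w (.copR c)))

theorem isContour_prod {f : Dart C P → F} (hf : ∀ x, f (dartRotation C P (edgeFlip w x)) = f x)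
    (p : P) : IsContour OutPort.prod (fun p => w.symm (.prodL p)) (fun p => w.symm (.prodR p))
      (fun o => f (.inl o)) (fun o => f (.inr (w o))) p where
  right := by simpa [edgeFlip, dartRotation] using hf (.inl (w.symm (.prodR p)))
  left := by simpa [edgeFlip, dartRotation] using hf (.inr (w (.prod p)))
  mid := by simpa [edgeFlip, dartRotation] using hf (.inl (w.symm (.prodL p)))

/-- A function that is constant along the contours of both trees is constant on the faces. -/
theorem dart_invariant_of_isContour {f : Dart C P → F}
    (hc : ∀ c, IsContour InPort.cop (fun c => w (.copR c)) (fun c => w (.copL c))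
      (fun i => f (.inr i)) (fun i => f (.inl (w.symm i))) c)
    (hp : ∀ p, IsContour OutPort.prod (fun p => w.symm (.prodL p)) (fun p => w.symm (.prodR p))
      (fun o => f (.inl o)) (fun o => f (.inr (w o))) p) (x : Dart C P) :
    f (dartRotation C P (edgeFlip w x)) = f x := by
  rcases x with o | i
  · obtain ⟨i, rfl⟩ := w.symm.surjective o
    cases i with
    | cop c => simpa [edgeFlip, dartRotation] using (hc c).left
    | prodL p => simpa [edgeFlip, dartRotation] using (hp p).mid
    | prodR p => simpa [edgeFlip, dartRotation] using (hp p).right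
  · obtain ⟨o, rfl⟩ := w.surjective i
    cases o with
    | copL c => simpa [edgeFlip, dartRotation] using (hc c).right
    | copR c => simpa [edgeFlip, dartRotation] using (hc c).mid
    | prod p => simpa [edgeFlip, dartRotation] using (hp p).left

/-- The face to the left of a dart. -/
def faceOf (w : OutPort C P ≃ InPort C P) (x : Dart C P) : Faces w :=
  Quotient.mk (Equiv.Perm.SameCycle.setoid ((edgeFlip w).trans (dartRotation C P))) x

theorem faceOf_step (w : OutPort C P ≃ InPort C P) (x : Dart C P) :
    faceOf w (dartRotation C P (edgeFlip w x)) = faceOf w x :=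
  Quotient.sound (s := Equiv.Perm.SameCycle.setoid ((edgeFlip w).trans (dartRotation C P)))
    (Equiv.Perm.sameCycle_apply_left.2 (Equiv.Perm.SameCycle.refl _ _))

theorem eq_of_faceOf_eq {f : Dart C P → F} (hf : ∀ x, f (dartRotation C P (edgeFlip w x)) = f x)
    {x y : Dart C P} (h : faceOf w x = faceOf w y) : f x = f y := by
  obtain ⟨k, rfl⟩ : Equiv.Perm.SameCycle ((edgeFlip w).trans (dartRotation C P)) x y :=
    Quotient.exact h
  clear h
  set σ : Equiv.Perm (Dart C P) := (edgeFlip w).trans (dartRotation C P)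
  have hσ : ∀ z, f (σ z) = f z := hf
  induction k generalizing x with
  | zero => rfl
  | succ k ih => rw [zpow_add_one, Equiv.Perm.mul_apply, ← ih, hσ]
  | pred k ih =>
    rw [zpow_sub_one, Equiv.Perm.mul_apply, ← ih]
    simpa using hσ (σ⁻¹ x)

namespace SplitsInto

/-- The faces at the root and at the leaves of the tree of products. -/
def faceList (w : OutPort C P ≃ InPort C P) (p₀ : P) (c₀ : C) (t : BinaryTree P) : List (Faces w) :=
  faceOf w (.inr (.cop c₀)) :: (prodLeaves w (.prod p₀) t).map fun o => faceOf w (.inl o)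

theorem length_faceList : (faceList w p₀ c₀ t).length = t.numNodes + 2 := by
  rw [faceList, List.length_cons, List.length_map, length_leafList]

theorem prodL_or_prodR_mem (h : SplitsInto w p₀ c₀ s t) {i : InPort C P} (hi : ∀ c, i ≠ .cop c) :
    w.symm i ∈ edgeList (fun p => w.symm (.prodL p)) (fun p => w.symm (.prodR p)) (.prod p₀) t := by
  cases i with
  | cop c => exact absurd rfl (hi c)
  | prodL p => exact left_mem_edgeList (L := fun p => w.symm (.prodL p)) (h.prod_mem p)
  | prodR p => exact right_mem_edgeList (R := fun p => w.symm (.prodR p)) (h.prod_mem p)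

/-- Along the contours, each side of an edge can be moved to the root or to a leaf. Leaves of the
coproduct tree are edges of the product tree, and the roots are the two ends of the closing edge.
This bounds the number of faces by `t.numNodes + 2`. -/
theorem mem_faceList (h : SplitsInto w p₀ c₀ s t) (φ : Faces w) : φ ∈ faceList w p₀ c₀ t := by
  have key : ∀ o ∈ edgeList (fun p => w.symm (.prodL p)) (fun p => w.symm (.prodR p))
      (.prod p₀) t, faceOf w (.inl o) ∈ faceList w p₀ c₀ t ∧
        faceOf w (.inr (w o)) ∈ faceList w p₀ c₀ t := fun o ho => by
    have h1 := h.prod.exists_mem_leafList (fun p _ => isContour_prod (faceOf_step w) p) ho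
    simp only [h.closing] at h1
    refine ⟨?_, ?_⟩
    · rcases h1.1 with h2 | ⟨y, hy, h2⟩
      · rw [h2]
        exact List.mem_cons_self
      · rw [h2]
        exact List.mem_cons_of_mem _ (List.mem_map_of_mem (f := fun o => faceOf w (.inl o)) hy)
    · rcases h1.2 with h2 | ⟨y, hy, h2⟩
      · rw [h2]
        exact List.mem_cons_self
      · rw [h2]
        exact List.mem_cons_of_mem _ (List.mem_map_of_mem (f := fun o => faceOf w (.inl o)) hy)
  have key' : ∀ i ∈ edgeList (fun c => w (.copR c)) (fun c => w (.copL c)) (.cop c₀) s,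
      faceOf w (.inr i) ∈ faceList w p₀ c₀ t ∧
        faceOf w (.inl (w.symm i)) ∈ faceList w p₀ c₀ t := fun i hi => by
    have h1 := h.cop.exists_mem_leafList (fun c _ => isContour_cop (faceOf_step w) c) hi
    have h2 : w.symm (.cop c₀) = .prod p₀ := by rw [← h.closing, Equiv.symm_apply_apply]
    have h3 : faceOf w (.inl (.prod p₀)) ∈ faceList w p₀ c₀ t := (key _ self_mem_edgeList).1
    have h4 : ∀ y ∈ leafList (fun c => w (.copR c)) (fun c => w (.copL c)) (.cop c₀) s,
        faceOf w (.inr y) ∈ faceList w p₀ c₀ t := fun y hy => by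
      have := (key _ (h.prodL_or_prodR_mem fun c => h.cop.ne_of_mem_leafList hy c)).2
      rwa [Equiv.apply_symm_apply] at this
    simp only [h2] at h1
    refine ⟨?_, ?_⟩
    · rcases h1.1 with h2 | ⟨y, hy, h2⟩
      · rwa [h2]
      · rw [h2]
        exact h4 y hy
    · rcases h1.2 with h2 | ⟨y, hy, h2⟩
      · rwa [h2]
      · rw [h2]
        exact h4 y hy
  obtain ⟨x, rfl⟩ : ∃ x, faceOf w x = φ := Quotient.exists_rep φ
  rcases x with o | i
  · cases o with
    | prod p => exact (key _ ((h.prod.mem_labels_iff OutPort.prod_injective).1 (h.prod_mem p))).1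
    | copL c =>
      have := (key' _ (right_mem_edgeList (R := fun c => w (.copL c)) (h.cop_mem c))).2
      rwa [Equiv.symm_apply_apply] at this
    | copR c =>
      have := (key' _ (left_mem_edgeList (L := fun c => w (.copR c)) (h.cop_mem c))).2
      rwa [Equiv.symm_apply_apply] at this
  · cases i with
    | cop c => exact (key' _ ((h.cop.mem_labels_iff InPort.cop_injective).1 (h.cop_mem c))).1
    | prodL p =>
      have := (key _ (left_mem_edgeList (L := fun p => w.symm (.prodL p)) (h.prod_mem p))).2
      rwa [Equiv.apply_symm_apply] at this
    | prodR p =>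
      have := (key _ (right_mem_edgeList (R := fun p => w.symm (.prodR p)) (h.prod_mem p))).2
      rwa [Equiv.apply_symm_apply] at this

/-- A leaf of the coproduct tree enters a product, and it starts at a coproduct because it is not
the closing edge. -/
theorem mem_prodLeaves (h : SplitsInto w p₀ c₀ s t) {i : InPort C P}
    (hi : i ∈ copLeaves w (.cop c₀) s) : w.symm i ∈ prodLeaves w (.prod p₀) t := by
  have hne := fun c => h.cop.ne_of_mem_leafList hi c
  refine h.prod.mem_leafList_of_ne (h.prodL_or_prodR_mem hne) fun p hp => ?_
  rw [Equiv.symm_apply_eq] at hp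
  have h1 := h.cop.mem_edgeList_of_mem_leafList hi
  simp only [edgeList, List.mem_cons, List.mem_flatMap, List.not_mem_nil, or_false] at h1
  rcases h1 with h1 | ⟨d, -, h1 | h1⟩
  · exact hne _ h1
  · simp [hp] at h1
  · simp [hp] at h1

/-- If there are enough faces, then the leaves of the two trees are joined in their order. -/
theorem realizes (h : SplitsInto w p₀ c₀ s t) (hn : s.numNodes = t.numNodes)
    (hF : Nat.card (Faces w) = t.numNodes + 2) : Realizes w p₀ c₀ s t := by
  refine ⟨h, ?_⟩
  -- The list contains all faces and has as many entries as there are faces, so nothing is repeated.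
  have hnd : (faceList w p₀ c₀ t).Nodup := by
    rw [List.nodup_iff_card_eq_length h.mem_faceList, hF, length_faceList]
  have h1 := h.prod.map_leafList fun p _ => isContour_prod (faceOf_step w) p
  have h2 := h.cop.map_leafList fun c _ => isContour_cop (faceOf_step w) c
  have h3 : w.symm (.cop c₀) = .prod p₀ := by rw [← h.closing, Equiv.symm_apply_apply]
  simp only [h.closing] at h1
  simp only [h3] at h2
  rw [faceList, ← h1] at hnd
  have hV := List.inj_on_of_nodup_map (List.nodup_append.1 hnd).1
  -- Both leaf sequences, the one from `s` reversed, lead from the same face to the same face. The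
  -- face on one side of a leaf determines that leaf, so the two sequences agree term by term.
  have e := List.eq_of_map_append_eq_cons (U := fun o => faceOf w (.inl o))
    (V := fun o => faceOf w (.inr (w o))) (D := {o | o ∈ prodLeaves w (.prod p₀) t})
    (K := prodLeaves w (.prod p₀) t) (M := (copLeaves w (.cop c₀) s).reverse.map w.symm)
    (fun x hx y hy hxy => hV hx hy hxy) (by simp [length_leafList, hn]) (fun x hx => hx)
    (fun x hx => by
      obtain ⟨i, hi, rfl⟩ := List.mem_map.1 hx
      exact h.mem_prodLeaves (List.mem_reverse.1 hi))
    h1 (by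
      have h4 := congrArg List.reverse h2
      simp only [List.reverse_append, List.reverse_cons, List.reverse_nil, List.nil_append,
        List.singleton_append] at h4
      rw [List.map_map, List.map_map, List.map_reverse, List.map_reverse]
      refine Eq.trans ?_ h4.symm
      simp [Function.comp_def])
  rw [e, List.map_map, Equiv.self_comp_symm, List.map_id]

end SplitsInto

/-! ### The number of faces of a gluing -/

theorem Unfolds.map_leafList_right {N X : Type} {κ L R : N → X} {v : X} {t : BinaryTree N}
    {U V : X → ℕ} {a : ℕ} (h : Unfolds κ L R v t) (hc : ∀ c ∈ t.labels, IsContour κ L R U V c)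
    (hV : V v = a) (hU : U v = a + (t.numNodes + 1))
    (hl : (leafList L R v t).map V = List.range' a (t.numNodes + 1)) :
    (leafList L R v t).map U = List.range' (a + 1) (t.numNodes + 1) := by
  have h1 := h.map_leafList hc
  rw [hl, hU, hV, ← List.range'_1_concat, List.range'_succ, List.cons.injEq] at h1
  exact h1.2.symm

theorem List.map_sub_reverse_range' (m a b : ℕ) (h : a + b = 1) :
    (List.range' a m).reverse.map (fun x => m - x) = List.range' b m := by
  refine List.ext_getElem (by simp) fun i h1 h2 => ?_
  simp only [List.length_map, List.length_reverse, List.length_range'] at h1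
  simp only [List.getElem_map, List.getElem_reverse, List.getElem_range', List.length_range']
  omega

/-- The gluing of two trees is planar. -/
theorem Realizes.card_faces (h : Realizes w p₀ c₀ s t) : Nat.card (Faces w) = t.numNodes + 2 := by
  have hn : s.numNodes = t.numNodes := by
    have := congrArg List.length h.glue
    simpa [length_leafList] using this.symm
  obtain ⟨Uc, Vc, hc, hVc, hUc, hlc⟩ :=
    h.cop.exists_contour ((copBranching h.closing).nodup_edgeList h.cop_nodup) 0
  obtain ⟨Up, Vp, hp, hVp, hUp, hlp⟩ :=
    h.prod.exists_contour ((prodBranching h.closing).nodup_edgeList h.prod_nodup) 0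
  have hlc' := h.cop.map_leafList_right hc hVc hUc hlc
  have hlp' := h.prod.map_leafList_right hp hVp hUp hlp
  rw [hn] at hUc hlc hlc'
  rw [zero_add] at hUc hUp hlc' hlp'
  set m := t.numNodes + 1 with hm
  -- The contour of `s` is numbered in the opposite direction, so its numbers `x` must be read as `m
  -- - x`; by the gluing both numberings then agree on the leaves.
  have hleafU : ∀ o ∈ prodLeaves w (.prod p₀) t, Up o = m - Vc (w o) := by
    refine List.map_inj_left.1 ?_
    have := congrArg (List.map fun i => m - Vc i) h.glue
    rw [List.map_map, List.map_reverse] at this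
    refine hlp'.trans (Eq.trans ?_ this.symm)
    rw [← List.map_sub_reverse_range' m 0 1 rfl, ← hlc, ← List.map_reverse, List.map_map,
      List.map_reverse]
    rfl
  have hleafV : ∀ o ∈ prodLeaves w (.prod p₀) t, Vp o = m - Uc (w o) := by
    refine List.map_inj_left.1 ?_
    have := congrArg (List.map fun i => m - Uc i) h.glue
    rw [List.map_map, List.map_reverse] at this
    refine hlp.trans (Eq.trans ?_ this.symm)
    rw [← List.map_sub_reverse_range' m 1 0 rfl, ← hlc', ← List.map_reverse, List.map_map,
      List.map_reverse]
    rfl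
  -- Half-edges of products use the product numbering, those of coproducts the reversed coproduct
  -- numbering. By `key` and `key'` each formula holds on every edge of its tree, including leaves
  -- and the closing edge, so `f` is constant on faces.
  let f : Dart C P → ℕ := fun x => match x with
    | .inl (.prod p) => Up (.prod p)
    | .inl o => m - Vc (w o)
    | .inr (.cop c) => m - Uc (.cop c)
    | .inr i => Vp (w.symm i)
  have hp₀ : w.symm (.cop c₀) = .prod p₀ := by rw [← h.closing, Equiv.symm_apply_apply]
  have key : ∀ o ∈ edgeList (fun p => w.symm (.prodL p)) (fun p => w.symm (.prodR p))
      (.prod p₀) t, f (.inl o) = Up o ∧ f (.inr (w o)) = Vp o := fun o ho => by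
    have h2 : o ≠ .prod p₀ → ∀ c, w o ≠ .cop c := fun hne c hcc => by
      simp only [edgeList, List.mem_cons, hne, List.mem_flatMap, List.not_mem_nil, or_false,
        false_or] at ho
      obtain ⟨q, -, rfl | rfl⟩ := ho <;> simp at hcc
    refine ⟨?_, ?_⟩
    · cases o with
      | prod p => rfl
      | copL c => exact (hleafU _ (h.prod.mem_leafList_of_ne ho fun p => by simp)).symm
      | copR c => exact (hleafU _ (h.prod.mem_leafList_of_ne ho fun p => by simp)).symm
    · by_cases hne : o = .prod p₀
      · rw [hne, h.closing, hVp]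
        simp only [f, hUc]
        omega
      · have h3 := h2 hne
        have h4 : w.symm (w o) = o := w.symm_apply_apply o
        generalize w o = i at h3 h4
        rw [← h4]
        cases i with
        | cop c => exact absurd rfl (h3 c)
        | prodL q => rfl
        | prodR q => rfl
  have key' : ∀ i ∈ edgeList (fun c => w (.copR c)) (fun c => w (.copL c)) (.cop c₀) s,
      f (.inr i) = m - Uc i ∧ f (.inl (w.symm i)) = m - Vc i := fun i hi => by
    have h2 : i ≠ .cop c₀ → ∀ p, w.symm i ≠ .prod p := fun hne c hcc => by
      simp only [edgeList, List.mem_cons, hne, List.mem_flatMap, List.not_mem_nil, or_false,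
        false_or] at hi
      obtain ⟨q, -, rfl | rfl⟩ := hi <;> simp at hcc
    refine ⟨?_, ?_⟩
    · have h5 : (∀ c, i ≠ .cop c) → Vp (w.symm i) = m - Uc i := fun hne => by
        rw [hleafV _ (h.mem_prodLeaves (h.cop.mem_leafList_of_ne hi hne)), Equiv.apply_symm_apply]
      cases i with
      | cop p => rfl
      | prodL q => exact h5 fun c => by simp
      | prodR q => exact h5 fun c => by simp
    · by_cases hne : i = .cop c₀
      · rw [hne, hp₀, hVc]
        simp only [f, hUp]
        omega
      · have h3 := h2 hne
        have h4 : w (w.symm i) = i := w.apply_symm_apply i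
        generalize w.symm i = o at h3 h4
        rw [← h4]
        cases o with
        | prod p => exact absurd rfl (h3 p)
        | copL q => rfl
        | copR q => rfl
  have hf : ∀ x, f (dartRotation C P (edgeFlip w x)) = f x := by
    refine dart_invariant_of_isContour (fun c => ?_) fun p => ?_
    · have hcc := hc c (h.cop_mem c)
      have k1 := key' _ ((h.cop.mem_labels_iff InPort.cop_injective).1 (h.cop_mem c))
      have k2 := key' _ (left_mem_edgeList (L := fun c => w (.copR c)) (h.cop_mem c))
      have k3 := key' _ (right_mem_edgeList (R := fun c => w (.copL c)) (h.cop_mem c))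
      exact ⟨by rw [k1.1, k3.1, hcc.right], by rw [k2.2, k1.2, hcc.left],
        by rw [k3.2, k2.1, hcc.mid]⟩
    · have hpp := hp p (h.prod_mem p)
      have k1 := key _ ((h.prod.mem_labels_iff OutPort.prod_injective).1 (h.prod_mem p))
      have k2 := key _ (left_mem_edgeList (L := fun p => w.symm (.prodL p)) (h.prod_mem p))
      have k3 := key _ (right_mem_edgeList (R := fun p => w.symm (.prodR p)) (h.prod_mem p))
      exact ⟨by rw [k1.1, k3.1, hpp.right], by rw [k2.2, k1.2, hpp.left],
        by rw [k3.2, k2.1, hpp.mid]⟩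
  rw [← SplitsInto.length_faceList (w := w) (p₀ := p₀) (c₀ := c₀),
    ← List.nodup_iff_card_eq_length h.mem_faceList]
  let g : Faces w → ℕ := Quotient.lift f fun x y hxy =>
    eq_of_faceOf_eq hf (Quotient.sound hxy)
  have hg : ∀ x, g (faceOf w x) = f x := fun _ => rfl
  -- The faces in the list receive the distinct numbers `0, …, m`.
  refine List.Nodup.of_map g ?_
  have e : (SplitsInto.faceList w p₀ c₀ t).map g = List.range' 0 (m + 1) := by
    rw [SplitsInto.faceList, List.map_cons, List.map_map, List.range'_succ, zero_add, ← hlp']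
    congr 1
    · rw [hg]
      have := (key _ self_mem_edgeList).2
      rwa [h.closing, hVp] at this
    · exact List.map_congr_left fun o ho => (key o (h.prod.mem_edgeList_of_mem_leafList ho)).1
  rw [e]
  exact List.nodup_range'

end Faces

/-! ### Avoiding prographs are gluings -/

section Card

variable {C P : Type}

/-- Outputs as a sum type. -/
def OutPort.equivSum : OutPort C P ≃ C ⊕ C ⊕ P where
  toFun
    | .copL c => .inl c
    | .copR c => .inr (.inl c)
    | .prod p => .inr (.inr p)
  invFun
    | .inl c => .copL c
    | .inr (.inl c) => .copR c
    | .inr (.inr p) => .prod p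
  left_inv := by rintro (c | c | p) <;> rfl
  right_inv := by rintro (c | c | p) <;> rfl

/-- Inputs as a sum type. -/
def InPort.equivSum : InPort C P ≃ C ⊕ P ⊕ P where
  toFun
    | .cop c => .inl c
    | .prodL p => .inr (.inl p)
    | .prodR p => .inr (.inr p)
  invFun
    | .inl c => .cop c
    | .inr (.inl p) => .prodL p
    | .inr (.inr p) => .prodR p
  left_inv := by rintro (c | p | p) <;> rfl
  right_inv := by rintro (c | p | p) <;> rfl

theorem OutPort.card [Finite C] [Finite P] :
    Nat.card (OutPort C P) = Nat.card C + (Nat.card C + Nat.card P) := by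
  rw [Nat.card_congr OutPort.equivSum, Nat.card_sum, Nat.card_sum]

theorem InPort.card [Finite C] [Finite P] :
    Nat.card (InPort C P) = Nat.card C + (Nat.card P + Nat.card P) := by
  rw [Nat.card_congr InPort.equivSum, Nat.card_sum, Nat.card_sum]

end Card

theorem mirror_mirror (S : BinaryTree Unit) : mirror (mirror S) = S := by
  induction S with
  | nil => rfl
  | node _ a b iha ihb => rw [mirror, mirror, iha, ihb]

theorem numNodes_mirror (S : BinaryTree Unit) : (mirror S).numNodes = S.numNodes := by
  induction S with
  | nil => rfl
  | node _ a b iha ihb =>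
    rw [mirror, numNodes, iha, ihb, numNodes]
    omega

theorem List.mem_of_nodup_of_card_le {α : Type} [Finite α] {l : List α} (hl : l.Nodup)
    (h : Nat.card α ≤ l.length) (a : α) : a ∈ l := by
  classical
  have := Fintype.ofFinite α
  rw [Nat.card_eq_fintype_card] at h
  have h1 : l.toFinset = Finset.univ :=
    (Finset.card_eq_iff_eq_univ _).1 (le_antisymm (Finset.card_le_univ _)
      (by rwa [List.toFinset_card_of_nodup hl]))
  rw [← List.mem_toFinset, h1]
  exact Finset.mem_univ a

theorem wellFounded_of_transGen_irrefl {α : Type} [Finite α] {r : α → α → Prop}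
    (h : ∀ x, ¬ TransGen r x x) : WellFounded r := by
  have : Std.Irrefl (TransGen r) := ⟨h⟩
  exact Subrelation.wf TransGen.single (Finite.wellFounded_of_trans_of_irrefl (TransGen r))

namespace LabelledPrograph

variable {C P : Type} (G : LabelledPrograph C P)

theorem wellFounded_edgeRel [Finite C] [Finite P] : WellFounded (EdgeRel G.wire G.north) :=
  wellFounded_of_transGen_irrefl G.acyclic

theorem wellFounded_swap_edgeRel [Finite C] [Finite P] :
    WellFounded (Function.swap (EdgeRel G.wire G.north)) :=
  wellFounded_of_transGen_irrefl fun x hx => G.acyclic x (transGen_swap.1 hx)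

variable {G}

theorem edgeRel_of_cop {c d : C}
    (h : InPort.cop d = G.wire (.copR c) ∨ InPort.cop d = G.wire (.copL c)) :
    EdgeRel G.wire G.north (.inl c) (.inl d) := by
  rcases h with h | h
  · exact ⟨.copR c, by simp, rfl, by rw [← h]; rfl⟩
  · exact ⟨.copL c, by simp, rfl, by rw [← h]; rfl⟩

theorem edgeRel_of_prod {p q : P}
    (h : OutPort.prod q = G.wire.symm (.prodL p) ∨ OutPort.prod q = G.wire.symm (.prodR p)) :
    EdgeRel G.wire G.north (.inr q) (.inr p) := by
  rw [Equiv.eq_symm_apply, Equiv.eq_symm_apply] at h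
  refine ⟨.prod q, fun hq => ?_, rfl, ?_⟩
  · rw [hq, G.closing] at h
    simp at h
  · rcases h with h | h <;> rw [h] <;> rfl

section Finite

variable [Finite C] [Finite P]

/-- Both directions are needed: with parents below children for the distinctness and completeness of
the labels, reversed for the termination of the unfolding. -/
theorem wellFounded_cop : WellFounded fun c d : C =>
    InPort.cop d = G.wire (.copR c) ∨ InPort.cop d = G.wire (.copL c) :=
  Subrelation.wf edgeRel_of_cop (InvImage.wf Sum.inl G.wellFounded_edgeRel)

theorem wellFounded_cop_swap : WellFounded fun d c : C =>
    InPort.cop d = G.wire (.copR c) ∨ InPort.cop d = G.wire (.copL c) :=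
  Subrelation.wf edgeRel_of_cop (InvImage.wf Sum.inl G.wellFounded_swap_edgeRel)

theorem wellFounded_prod : WellFounded fun p q : P =>
    OutPort.prod q = G.wire.symm (.prodL p) ∨ OutPort.prod q = G.wire.symm (.prodR p) :=
  Subrelation.wf edgeRel_of_prod (InvImage.wf Sum.inr G.wellFounded_swap_edgeRel)

theorem wellFounded_prod_swap : WellFounded fun q p : P =>
    OutPort.prod q = G.wire.symm (.prodL p) ∨ OutPort.prod q = G.wire.symm (.prodR p) :=
  Subrelation.wf edgeRel_of_prod (InvImage.wf Sum.inr G.wellFounded_edgeRel)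

/-- Without an edge from a product to a coproduct, each operator other than the root has a parent of
its own kind, so each kind forms one tree. Planarity then forces the matching of the leaves. -/
theorem exists_realizedBy (hcard : Nat.card C = Nat.card P) (h : ¬ G.HasProdCopEdge) :
    ∃ s t, G.RealizedBy s t := by
  obtain ⟨s, hs⟩ := exists_unfolds G.wellFounded_cop_swap (.cop G.south)
  obtain ⟨t, ht⟩ := exists_unfolds G.wellFounded_prod_swap (.prod G.north)
  have hno : ∀ p c, p ≠ G.north → G.wire (.prod p) ≠ .cop c := fun p c hp hc => h ⟨p, c, hp, hc⟩
  have hsp : SplitsInto G.wire G.north G.south s t :=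
    { closing := G.closing
      cop := hs
      prod := ht
      cop_nodup := hs.nodup_labels (copBranching G.closing) G.wellFounded_cop
      cop_mem := hs.mem_labels InPort.cop_injective G.wellFounded_cop fun c => by
        obtain ⟨o, ho⟩ := G.wire.surjective (.cop c)
        cases o with
        | copL d => exact Or.inr ⟨d, Or.inr ho.symm⟩
        | copR d => exact Or.inr ⟨d, Or.inl ho.symm⟩
        | prod p =>
          by_cases hp : p = G.north
          · rw [← ho, hp, G.closing]
            exact Or.inl rfl
          · exact absurd ho (hno p c hp)
      prod_nodup := ht.nodup_labels (prodBranching G.closing) G.wellFounded_prod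
      prod_mem := ht.mem_labels OutPort.prod_injective G.wellFounded_prod fun p => by
        by_cases hp : p = G.north
        · exact Or.inl (by rw [hp])
        · right
          cases hi : G.wire (.prod p) with
          | cop c => exact absurd hi (hno p c hp)
          | prodL q => exact ⟨q, Or.inl ((Equiv.eq_symm_apply _).2 hi)⟩
          | prodR q => exact ⟨q, Or.inr ((Equiv.eq_symm_apply _).2 hi)⟩ }
  refine ⟨s, t, hsp.realizes ?_ ?_⟩
  · rw [hsp.numNodes_cop, hsp.numNodes_prod, hcard]
  -- With `n` operators of each kind, Euler's formula reads `2n + F = 3n + 2`.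
  · have h1 := G.planar
    rw [OutPort.card, Nat.card_sum] at h1
    rw [hsp.numNodes_prod]
    omega

end Finite

/-! ### Comparison with `CopTree` and `ProdTree` -/

theorem CopTree.exists_unfolds {e : OutPort C P} {S : BinaryTree Unit} {K : List (OutPort C P)}
    (h : CopTree G e S K) : ∃ s, CopUnfolds G.wire (G.wire e) s ∧ s.shape = mirror S ∧
      K.map G.wire = (copLeaves G.wire (G.wire e) s).reverse := by
  induction h with
  | leaf e he => exact ⟨.nil, he, rfl, rfl⟩
  | node e c he S T K L _ _ ihS ihT =>
    obtain ⟨s, h1, h2, h3⟩ := ihS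
    obtain ⟨t, h4, h5, h6⟩ := ihT
    refine ⟨.node c t s, ⟨he, h4, h1⟩, ?_, ?_⟩
    · rw [mirror, ← h2, ← h5]
      rfl
    · rw [List.map_append, h3, h6, ← List.reverse_append]
      rfl

theorem copTree_of_unfolds {e : OutPort C P} {s : BinaryTree C}
    (h : CopUnfolds G.wire (G.wire e) s) :
    CopTree G e (mirror s.shape) ((copLeaves G.wire (G.wire e) s).reverse.map G.wire.symm) := by
  induction s generalizing e with
  | nil => simpa [leafList, shape, BinaryTree.map, mirror] using CopTree.leaf (G := G) e h
  | node c s t ihs iht =>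
    have := CopTree.node e c h.1 _ _ _ _ (iht h.2.2) (ihs h.2.1)
    rw [← List.map_append, ← List.reverse_append] at this
    exact this

theorem ProdTree.exists_unfolds {e : OutPort C P} {T : BinaryTree Unit} {K : List (OutPort C P)}
    (h : ProdTree G e T K) : ∃ t, ProdUnfolds G.wire e t ∧ t.shape = T ∧
      K = prodLeaves G.wire e t := by
  induction h with
  | leaf e he => exact ⟨.nil, he, rfl, rfl⟩
  | node p S T K L _ _ ihS ihT =>
    obtain ⟨s, h1, rfl, rfl⟩ := ihS
    obtain ⟨t, h4, rfl, rfl⟩ := ihT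
    exact ⟨.node p s t, ⟨rfl, h1, h4⟩, rfl, rfl⟩

theorem prodTree_of_unfolds {e : OutPort C P} {t : BinaryTree P}
    (h : ProdUnfolds G.wire e t) : ProdTree G e t.shape (prodLeaves G.wire e t) := by
  induction t generalizing e with
  | nil => exact ProdTree.leaf e h
  | node p s t ihs iht =>
    obtain ⟨rfl, h1, h2⟩ := h
    exact ProdTree.node p _ _ _ _ (ihs h1) (iht h2)

/-- Acyclicity makes the labels of both unfolded trees distinct, so the node counts force every
operator to occur. -/
theorem isGluing_iff [Finite C] [Finite P] {S T : BinaryTree Unit} :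
    G.IsGluing S T ↔ ∃ s t, G.RealizedBy s t ∧ s.shape = mirror S ∧ t.shape = T := by
  constructor
  · rintro ⟨hS, hT, K, hc, hp⟩
    obtain ⟨s, h1, h2, h3⟩ := hc.exists_unfolds
    obtain ⟨t, h4, h5, rfl⟩ := hp.exists_unfolds
    rw [G.closing] at h1 h3
    have hs := h1.nodup_labels (copBranching G.closing) G.wellFounded_cop
    have ht := h4.nodup_labels (prodBranching G.closing) G.wellFounded_prod
    refine ⟨s, t, ⟨⟨G.closing, h1, h4, hs, List.mem_of_nodup_of_card_le hs ?_, ht,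
      List.mem_of_nodup_of_card_le ht ?_⟩, h3⟩, h2, h5⟩
    · rw [← hS, length_labels, ← numNodes_shape s, h2, numNodes_mirror]
    · rw [← hT, length_labels, ← numNodes_shape t, h5]
  · rintro ⟨s, t, h, hs, rfl⟩
    refine ⟨?_, ?_, prodLeaves G.wire (.prod G.north) t, ?_, prodTree_of_unfolds h.prod⟩
    · rw [← h.numNodes_cop, ← numNodes_shape s, hs, numNodes_mirror]
    · rw [numNodes_shape, h.numNodes_prod]
    · have h1 := copTree_of_unfolds (G := G) (e := .prod G.north) (s := s)
        (by rw [G.closing]; exact h.cop)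
      rw [G.closing, ← h.glue, hs, mirror_mirror, List.map_map, Equiv.symm_comp_self,
        List.map_id] at h1
      exact h1

end LabelledPrograph

/-! ### Gluing two trees -/

section InnerList

variable {N X Y : Type}

/-- The inner edges of an unfolded tree, together with the nodes that they enter. -/
def innerList (l r : N → Y) : Y → BinaryTree N → List (Y × N)
  | _, .nil => []
  | y, .node c s t => (y, c) :: (innerList l r (l c) s ++ innerList l r (r c) t)

theorem map_snd_innerList (l r : N → Y) (y : Y) (t : BinaryTree N) :
    (innerList l r y t).map Prod.snd = t.labels := by
  induction t generalizing y with
  | nil => rfl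
  | node c s t ihs iht => simp [innerList, labels, ihs, iht]

theorem innerList_perm (l r : N → Y) (y : Y) (t : BinaryTree N) :
    ((innerList l r y t).map Prod.fst ++ leafList l r y t).Perm (edgeList l r y t) := by
  induction t generalizing y with
  | nil => simp [innerList, leafList, edgeList, labels]
  | node c s t ihs iht =>
    refine List.Perm.trans ?_ (edgeList_node_perm c s t).symm
    simp only [innerList, leafList, List.map_cons, List.map_append, List.cons_append,
      List.perm_cons]
    refine List.Perm.trans ?_ ((ihs (l c)).append (iht (r c)))
    simp only [List.append_assoc]
    refine List.Perm.append_left _ ?_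
    simp only [← List.append_assoc]
    exact List.perm_append_comm.append_right _

theorem mem_leafList_cases {l r : N → Y} {x y : Y} {t : BinaryTree N} (h : x ∈ leafList l r y t) :
    (t = .nil ∧ x = y) ∨ ∃ c, x = l c ∨ x = r c := by
  induction t generalizing y with
  | nil => exact Or.inl ⟨rfl, by simpa [leafList] using h⟩
  | node c s t ihs iht =>
    rcases List.mem_append.1 h with h | h
    · rcases ihs h with ⟨-, h⟩ | h
      · exact Or.inr ⟨c, Or.inl h⟩
      · exact Or.inr h
    · rcases iht h with ⟨-, h⟩ | h
      · exact Or.inr ⟨c, Or.inr h⟩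
      · exact Or.inr h

theorem unfolds_of_innerList {l r : N → Y} {β : Y → X} {κ : N → X} {y : Y} {t : BinaryTree N}
    (h : ∀ z ∈ innerList l r y t, β z.1 = κ z.2) (h' : ∀ z ∈ leafList l r y t, ∀ c, β z ≠ κ c) :
    Unfolds κ (fun c => β (l c)) (fun c => β (r c)) (β y) t := by
  induction t generalizing y with
  | nil => exact h' y (by simp [leafList])
  | node c s t ihs iht =>
    simp only [innerList, List.mem_cons, List.mem_append] at h
    simp only [leafList, List.mem_append] at h'
    exact ⟨h (y, c) (Or.inl rfl), ihs (fun z hz => h z (by simp [hz])) fun z hz => h' z (Or.inl hz),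
      iht (fun z hz => h z (by simp [hz])) fun z hz => h' z (Or.inr hz)⟩

/-- A complete list of pairs of the right length defines a bijection. -/
theorem exists_equiv_of_list {A B : Type} (Z : List (A × B)) (hA : ∀ a, a ∈ Z.map Prod.fst)
    (hB : ∀ b, b ∈ Z.map Prod.snd) (cA : Nat.card A = Z.length) (cB : Nat.card B = Z.length) :
    ∃ w : A ≃ B, ∀ z ∈ Z, w z.1 = z.2 := by
  classical
  -- A list that contains everything and has the length of the cardinality has no repetitions;
  -- positions then give the bijection.
  have nA : (Z.map Prod.fst).Nodup := by rwa [List.nodup_iff_card_eq_length hA, List.length_map]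
  have nB : (Z.map Prod.snd).Nodup := by rwa [List.nodup_iff_card_eq_length hB, List.length_map]
  refine ⟨(nA.getEquivOfForallMemList _ hA).symm.trans ((finCongr (by simp)).trans
    (nB.getEquivOfForallMemList _ hB)), fun z hz => ?_⟩
  obtain ⟨i, hi, rfl⟩ := List.getElem_of_mem hz
  have e : (nA.getEquivOfForallMemList _ hA).symm Z[i].1 = ⟨i, by simpa using hi⟩ := by
    rw [Equiv.symm_apply_eq]
    simp
  rw [Equiv.trans_apply, e]
  simp

end InnerList

section Gluing

variable {C P : Type}

/-- Two trees with the same number of leaves can be glued. -/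
theorem exists_realizes [Finite C] [Finite P] (hcard : Nat.card C = Nat.card P)
    {s : BinaryTree C} {t : BinaryTree P} (hs : s.labels.Nodup) (hs' : ∀ c, c ∈ s.labels)
    (ht : t.labels.Nodup) (ht' : ∀ p, p ∈ t.labels) (hne : t ≠ .nil) :
    ∃ (w : OutPort C P ≃ InPort C P) (p₀ : P) (c₀ : C), Realizes w p₀ c₀ s t := by
  have cs : s.numNodes = Nat.card C := by
    rw [← length_labels, (List.nodup_iff_card_eq_length hs').1 hs]
  have ct : t.numNodes = Nat.card P := by
    rw [← length_labels, (List.nodup_iff_card_eq_length ht').1 ht]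
  obtain _ | ⟨p₀, a, b⟩ := t
  · exact absurd rfl hne
  obtain _ | ⟨c₀, x, y⟩ := s
  · simp only [numNodes] at cs ct
    omega
  set s : BinaryTree C := .node c₀ x y with hsdef
  set t : BinaryTree P := .node p₀ a b with htdef
  let I := innerList OutPort.copR OutPort.copL (.prod p₀ : OutPort C P) s
  let K := leafList OutPort.copR OutPort.copL (.prod p₀ : OutPort C P) s
  -- The root pair of the product tree is left out: it is the closing edge, which `I` already
  -- contains.
  let J := innerList InPort.prodL InPort.prodR (.prodL p₀ : InPort C P) a ++
    innerList InPort.prodL InPort.prodR (.prodR p₀ : InPort C P) b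
  let M := leafList InPort.prodL InPort.prodR (.cop c₀ : InPort C P) t
  have hJ : innerList InPort.prodL InPort.prodR (.cop c₀ : InPort C P) t = (.cop c₀, p₀) :: J := rfl
  have hI := innerList_perm OutPort.copR OutPort.copL (.prod p₀ : OutPort C P) s
  have hJ' := innerList_perm InPort.prodL InPort.prodR (.cop c₀ : InPort C P) t
  have lI : I.length = s.numNodes := by
    rw [← length_labels, ← map_snd_innerList OutPort.copR OutPort.copL (.prod p₀ : OutPort C P) s,
      List.length_map]
  have lJ : J.length + 1 = t.numNodes := by
    rw [← length_labels, ← map_snd_innerList InPort.prodL InPort.prodR (.cop c₀ : InPort C P) t,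
      List.length_map, hJ, List.length_cons]
  have lK : K.length = s.numNodes + 1 := length_leafList _ _ _ _
  have lM : M.length = t.numNodes + 1 := length_leafList _ _ _ _
  have lKM : K.reverse.length = M.length := by rw [List.length_reverse]; omega
  have zK : (K.reverse.zip M).map Prod.fst = K.reverse := List.map_fst_zip lKM.le
  have zM : (K.reverse.zip M).map Prod.snd = M := List.map_snd_zip lKM.ge
  -- All edges of the gluing: `n` entering coproducts, `n + 1` leaves, and `n - 1` between products,
  -- in total the `3n` outputs or inputs.
  let Z : List (OutPort C P × InPort C P) :=
    I.map (fun z => (z.1, .cop z.2)) ++ (K.reverse.zip M ++ J.map fun z => (.prod z.2, z.1))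
  have hZ : Z.map Prod.fst = I.map Prod.fst ++ (K.reverse ++ J.map fun z => .prod z.2) := by
    simp only [Z, List.map_append, zK, List.map_map]
    rfl
  have hZ' : Z.map Prod.snd = I.map (fun z => .cop z.2) ++ (M ++ J.map Prod.fst) := by
    simp only [Z, List.map_append, zM, List.map_map]
    rfl
  have lZ : Z.length = s.numNodes + (s.numNodes + 1 + J.length) := by
    rw [← List.length_map (f := Prod.fst), hZ]
    simp [lI, lK]
  have mI : ∀ o, o ∈ edgeList OutPort.copR OutPort.copL (.prod p₀ : OutPort C P) s →
      o ∈ Z.map Prod.fst := fun o ho => by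
    rw [hZ, List.mem_append, List.mem_append, List.mem_reverse]
    rcases List.mem_append.1 (hI.mem_iff.2 ho) with h | h
    · exact Or.inl h
    · exact Or.inr (Or.inl h)
  have mJ : ∀ i, i ≠ .cop c₀ → i ∈ edgeList InPort.prodL InPort.prodR (.cop c₀ : InPort C P) t →
      i ∈ Z.map Prod.snd := fun i hi hi' => by
    rw [hZ', List.mem_append, List.mem_append]
    rcases List.mem_append.1 (hJ'.mem_iff.2 hi') with h | h
    · rw [hJ, List.map_cons, List.mem_cons] at h
      exact Or.inr (Or.inr (h.resolve_left hi))
    · exact Or.inr (Or.inl h)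
  obtain ⟨w, hw⟩ := exists_equiv_of_list Z
    (fun o => by
      cases o with
      | copL c => exact mI _ (right_mem_edgeList (hs' c))
      | copR c => exact mI _ (left_mem_edgeList (hs' c))
      | prod p =>
        by_cases hp : p = p₀
        · exact mI _ (hp ▸ self_mem_edgeList)
        · have h1 := ht' p
          rw [← map_snd_innerList InPort.prodL InPort.prodR (.cop c₀ : InPort C P) t, hJ,
            List.map_cons, List.mem_cons] at h1
          obtain ⟨z, hz, rfl⟩ := List.mem_map.1 (h1.resolve_left hp)
          rw [hZ, List.mem_append, List.mem_append]
          exact Or.inr (Or.inr (List.mem_map.2 ⟨z, hz, rfl⟩)))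
    (fun i => by
      cases i with
      | prodL p => exact mJ _ (by simp) (left_mem_edgeList (ht' p))
      | prodR p => exact mJ _ (by simp) (right_mem_edgeList (ht' p))
      | cop c =>
        have h1 := hs' c
        rw [← map_snd_innerList OutPort.copR OutPort.copL (.prod p₀ : OutPort C P) s] at h1
        obtain ⟨z, hz, rfl⟩ := List.mem_map.1 h1
        rw [hZ', List.mem_append]
        exact Or.inl (List.mem_map.2 ⟨z, hz, rfl⟩))
    (by rw [OutPort.card, lZ]; omega) (by rw [InPort.card, lZ]; omega)
  have hwI : ∀ z ∈ I, w z.1 = .cop z.2 := fun z hz =>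
    hw (z.1, .cop z.2) (List.mem_append_left _ (List.mem_map.2 ⟨z, hz, rfl⟩))
  have hwJ : ∀ z ∈ J, w (.prod z.2) = z.1 := fun z hz =>
    hw (.prod z.2, z.1) (List.mem_append_right _ (List.mem_append_right _
      (List.mem_map.2 ⟨z, hz, rfl⟩)))
  have hwK : K.reverse.map w = M := by
    rw [← zM]
    conv_lhs => rw [← zK]
    rw [List.map_map]
    exact List.map_congr_left fun z hz =>
      hw z (List.mem_append_right _ (List.mem_append_left _ hz))
  have hcl : w (.prod p₀) = .cop c₀ := hwI (.prod p₀, c₀) List.mem_cons_self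
  refine ⟨w, p₀, c₀, ⟨⟨hcl, ?_, ?_, hs, hs', ht, ht'⟩, ?_⟩⟩
  · have := unfolds_of_innerList (κ := InPort.cop) hwI fun o ho c hc => by
      have h1 : w o ∈ M := hwK ▸ List.mem_map_of_mem (List.mem_reverse.2 ho)
      rcases mem_leafList_cases h1 with ⟨h2, -⟩ | ⟨q, h2 | h2⟩
      · simp [htdef] at h2
      · simp [hc] at h2
      · simp [hc] at h2
    rwa [hcl] at this
  · have := unfolds_of_innerList (κ := OutPort.prod) (β := w.symm) (l := InPort.prodL)
      (r := InPort.prodR) (y := .cop c₀) (t := t)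
      (fun z hz => by
        rw [hJ, List.mem_cons] at hz
        rw [Equiv.symm_apply_eq]
        rcases hz with rfl | hz
        · exact hcl.symm
        · exact (hwJ z hz).symm)
      (fun i hi p hp => by
        have h1 : i ∈ K.reverse.map w := hwK ▸ hi
        obtain ⟨o, ho, rfl⟩ := List.mem_map.1 h1
        rw [Equiv.symm_apply_apply] at hp
        rcases mem_leafList_cases (List.mem_reverse.1 ho) with ⟨h2, -⟩ | ⟨q, h2 | h2⟩
        · simp [hsdef] at h2
        · simp [hp] at h2
        · simp [hp] at h2)
    rwa [← hcl, Equiv.symm_apply_apply] at this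
  · rw [prodLeaves_eq_map hcl, List.map_map, Equiv.self_comp_symm, List.map_id,
      copLeaves_eq_map hcl, ← List.map_reverse]
    exact hwK.symm

variable {w : OutPort C P ≃ InPort C P} {p₀ : P} {c₀ : C} {s : BinaryTree C} {t : BinaryTree P}

/-! ### Acyclicity and connectedness -/

namespace SplitsInto

/-- An operator is accessible once its successors are. Products are settled from the root outwards,
because the only successor of a product is its parent. Coproducts follow from the leaves inwards,
because their successors are roots of subtrees or products. -/
theorem wellFounded_swap_edgeRel (h : SplitsInto w p₀ c₀ s t) :
    WellFounded (Function.swap (EdgeRel w p₀)) := by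
  have hp : ∀ (t : BinaryTree P) (v : OutPort C P), ProdUnfolds w v t →
      (∀ p, v = .prod p → Acc (Function.swap (EdgeRel w p₀)) (.inr p)) →
      ∀ p ∈ t.labels, Acc (Function.swap (EdgeRel w p₀)) (.inr p) := fun t => by
    induction t with
    | nil => simp [labels]
    | node p a b iha ihb =>
      intro v hv hacc
      have h1 := hacc p hv.1
      have h2 : ∀ i : InPort C P, i.vertex = .inr p → ∀ q, w.symm i = .prod q →
          Acc (Function.swap (EdgeRel w p₀)) (.inr q) := fun i hi q hq => by
        refine ⟨_, ?_⟩
        rintro y ⟨o, -, ho, rfl⟩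
        cases o with
        | copL c => simp [OutPort.vertex] at ho
        | copR c => simp [OutPort.vertex] at ho
        | prod q' =>
          obtain rfl : q' = q := Sum.inr.inj ho
          rwa [← hq, Equiv.apply_symm_apply, hi]
      intro q hq
      simp only [labels, List.mem_cons, List.mem_append] at hq
      rcases hq with rfl | hq | hq
      · exact h1
      · exact iha _ hv.2.1 (h2 _ rfl) q hq
      · exact ihb _ hv.2.2 (h2 _ rfl) q hq
  have hp' : ∀ p, Acc (Function.swap (EdgeRel w p₀)) (.inr p) := fun p => by
    refine hp t _ h.prod (fun p hp => ⟨_, ?_⟩) p (h.prod_mem p)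
    -- The root product has no successor, as `EdgeRel` excludes the closing edge.
    obtain rfl : p₀ = p := OutPort.prod.inj hp
    rintro y ⟨o, hne, ho, rfl⟩
    cases o with
    | copL c => simp [OutPort.vertex] at ho
    | copR c => simp [OutPort.vertex] at ho
    | prod q => exact absurd (congrArg OutPort.prod (Sum.inr.inj ho)) hne
  have hc : ∀ (s : BinaryTree C) (v : InPort C P), CopUnfolds w v s →
      ∀ c ∈ s.labels, Acc (Function.swap (EdgeRel w p₀)) (.inl c) := fun s => by
    induction s with
    | nil => simp [labels]
    | node c a b iha ihb =>
      intro v hv d hd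
      simp only [labels, List.mem_cons, List.mem_append] at hd
      rcases hd with rfl | hd | hd
      · have h1 : ∀ (a : BinaryTree C) (i : InPort C P), CopUnfolds w i a →
            (∀ c ∈ a.labels, Acc (Function.swap (EdgeRel w p₀)) (.inl c)) →
            Acc (Function.swap (EdgeRel w p₀)) i.vertex := fun a i hi ha => by
          cases i with
          | cop e => exact ha e ((hi.mem_labels_iff InPort.cop_injective).2 self_mem_edgeList)
          | prodL q => exact hp' q
          | prodR q => exact hp' q
        refine ⟨_, ?_⟩
        rintro y ⟨o, -, ho, rfl⟩
        cases o with
        | copL e =>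
          obtain rfl : e = d := Sum.inl.inj ho
          exact h1 b _ hv.2.2 (ihb _ hv.2.2)
        | copR e =>
          obtain rfl : e = d := Sum.inl.inj ho
          exact h1 a _ hv.2.1 (iha _ hv.2.1)
        | prod q => simp [OutPort.vertex] at ho
      · exact iha _ hv.2.1 d hd
      · exact ihb _ hv.2.2 d hd
  exact ⟨fun x => by
    rcases x with c | p
    · exact hc s _ h.cop c (h.cop_mem c)
    · exact hp' p⟩

theorem acyclic (h : SplitsInto w p₀ c₀ s t) (x : C ⊕ P) : ¬ TransGen (EdgeRel w p₀) x x :=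
  fun hx => h.wellFounded_swap_edgeRel.transGen.irrefl.irrefl x (transGen_swap.2 hx)

/-- Following edges forward, through the left output at a coproduct, ends at the product `p₀`. -/
theorem connected [Finite C] [Finite P] (h : SplitsInto w p₀ c₀ s t) :
    (SimpleGraph.fromRel (EdgeRel w p₀)).Connected := by
  set Γ := SimpleGraph.fromRel (EdgeRel w p₀)
  have hwf : WellFounded (EdgeRel w p₀) := wellFounded_of_transGen_irrefl h.acyclic
  have hr : ∀ {x y}, EdgeRel w p₀ x y → Γ.Reachable x y := fun {x y} hxy => by
    by_cases hne : x = y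
    · rw [hne]
    · exact SimpleGraph.Adj.reachable ((SimpleGraph.fromRel_adj _ _ _).2 ⟨hne, Or.inl hxy⟩)
  have hp : ∀ x, ∀ p, x = Sum.inr p → Γ.Reachable (.inr p) (.inr p₀) := fun x => by
    induction x using h.wellFounded_swap_edgeRel.induction with
    | _ x ih =>
      rintro p rfl
      by_cases hp : p = p₀
      · rw [hp]
      · obtain ⟨q, hq⟩ := h.prod_eq hp
        have : EdgeRel w p₀ (.inr p) (.inr q) := ⟨.prod p, by simpa using hp, rfl, by
          rcases hq with hq | hq <;> rw [hq] <;> rfl⟩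
        exact (hr this).trans (ih _ this q rfl)
  have hc : ∀ x, ∀ c, x = Sum.inl c → Γ.Reachable (.inl c) (.inr p₀) := fun x => by
    induction x using h.wellFounded_swap_edgeRel.induction with
    | _ x ih =>
      rintro c rfl
      have : EdgeRel w p₀ (.inl c) (w (.copL c)).vertex := ⟨.copL c, by simp, rfl, rfl⟩
      refine (hr this).trans ?_
      cases hv : (w (.copL c)).vertex with
      | inl d => exact ih _ (hv ▸ this) d rfl
      | inr p => exact hp _ p rfl
  have key : ∀ x, Γ.Reachable x (.inr p₀) := by
    rintro (c | p)
    · exact hc _ c rfl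
    · exact hp _ p rfl
  exact { preconnected := fun x y => (key x).trans (key y).symm, nonempty := ⟨.inr p₀⟩ }

end SplitsInto

theorem LabelledPrograph.exists_of_labels [Finite C] [Finite P] (hcard : Nat.card C = Nat.card P)
    {s : BinaryTree C} {t : BinaryTree P} (hs : s.labels.Nodup) (hs' : ∀ c, c ∈ s.labels)
    (ht : t.labels.Nodup) (ht' : ∀ p, p ∈ t.labels) (hne : t ≠ .nil) :
    ∃ G : LabelledPrograph C P, G.RealizedBy s t := by
  obtain ⟨w, p₀, c₀, h⟩ := exists_realizes hcard hs hs' ht ht' hne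
  refine ⟨⟨w, p₀, c₀, h.closing, h.connected, h.acyclic, ?_⟩, h⟩
  rw [h.card_faces, OutPort.card, Nat.card_sum, h.numNodes_prod]
  omega

end Gluing

/-! ### The lattice of avoiding prographs -/

theorem exists_lattice_of_equiv {α β : Type} [Lattice β] (e : α ≃ β) {r : α → α → Prop}
    (h : ∀ a b, e a ≤ e b ↔ r a b) : ∃ L : Lattice α, ∀ a b, L.le a b ↔ r a b :=
  ⟨{  le := r
      le_refl := fun a => (h a a).1 le_rfl
      le_trans := fun a b c hab hbc => (h a c).1 (((h a b).2 hab).trans ((h b c).2 hbc))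
      le_antisymm := fun a b hab hba => e.injective (((h a b).2 hab).antisymm ((h b a).2 hba))
      sup := fun a b => e.symm (e a ⊔ e b)
      inf := fun a b => e.symm (e a ⊓ e b)
      le_sup_left := fun a b => (h _ _).1 (by simp)
      le_sup_right := fun a b => (h _ _).1 (by simp)
      sup_le := fun a b c hac hbc => (h _ _).1 (by simp [(h _ _).2 hac, (h _ _).2 hbc])
      inf_le_left := fun a b => (h _ _).1 (by simp)
      inf_le_right := fun a b => (h _ _).1 (by simp)
      le_inf := fun a b c hab hac => (h _ _).1 (by simp [(h _ _).2 hab, (h _ _).2 hac]) },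
    fun _ _ => Iff.rfl⟩

namespace PCPrograph

variable {n : ℕ}

/-- `Q` is the gluing of the mirror image of `S` with `T`. -/
def HasShapes (Q : PCPrograph n) (S T : BinaryTree Unit) : Prop :=
  ∃ (G : LabelledPrograph (Fin n) (Fin n)) (s t : BinaryTree (Fin n)),
    mk G = Q ∧ G.RealizedBy s t ∧ s.shape = S ∧ t.shape = T

variable {Q R : PCPrograph n} {S T S' T' : BinaryTree Unit}

theorem mk_eq_mk_iff {G H : LabelledPrograph (Fin n) (Fin n)} : mk G = mk H ↔ G.Iso H :=
  ⟨fun h => Quotient.exact h, fun h => Quotient.sound (s := progSetoid n) h⟩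

theorem isGluing_iff_hasShapes : Q.IsGluing S T ↔ Q.HasShapes (mirror S) T := by
  constructor
  · rintro ⟨G, hG, h⟩
    obtain ⟨s, t, h1, h2, h3⟩ := LabelledPrograph.isGluing_iff.1 h
    exact ⟨G, s, t, hG, h1, h2, h3⟩
  · rintro ⟨G, s, t, hG, h1, h2, h3⟩
    exact ⟨G, hG, LabelledPrograph.isGluing_iff.2 ⟨s, t, h1, h2, h3⟩⟩

theorem HasShapes.of_mk_eq (h : Q.HasShapes S T) {G : LabelledPrograph (Fin n) (Fin n)}
    (hG : mk G = Q) :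
    ∃ s t : BinaryTree (Fin n), G.RealizedBy s t ∧ s.shape = S ∧ t.shape = T := by
  obtain ⟨H, s, t, hH, h1, rfl, rfl⟩ := h
  obtain ⟨s', t', h2, h3, h4⟩ := h1.exists_of_iso (mk_eq_mk_iff.1 (hH.trans hG.symm))
  exact ⟨s', t', h2, h3, h4⟩

theorem HasShapes.avoidsProdCop (h : Q.HasShapes S T) : Q.AvoidsProdCop := by
  intro G hG
  obtain ⟨s, t, h1, -, -⟩ := h.of_mk_eq hG
  exact h1.not_hasProdCopEdge

theorem AvoidsProdCop.exists_hasShapes (h : Q.AvoidsProdCop) :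
    ∃ S T : BinaryTree Unit, Q.HasShapes S T := by
  obtain ⟨G, rfl⟩ : ∃ G, mk G = Q := Quotient.exists_rep Q
  obtain ⟨s, t, hst⟩ := LabelledPrograph.exists_realizedBy rfl (h G rfl)
  exact ⟨_, _, G, s, t, rfl, hst, rfl, rfl⟩

theorem HasShapes.numNodes_eq (h : Q.HasShapes S T) : S.numNodes = n ∧ T.numNodes = n := by
  obtain ⟨G, s, t, -, h, rfl, rfl⟩ := h
  rw [numNodes_shape, numNodes_shape, h.numNodes_cop, h.numNodes_prod, Nat.card_fin]
  exact ⟨rfl, rfl⟩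

theorem HasShapes.unique (h : Q.HasShapes S T) (h' : R.HasShapes S T) : Q = R := by
  obtain ⟨G, s, t, rfl, h1, rfl, rfl⟩ := h
  obtain ⟨H, s', t', rfl, h2, h3, h4⟩ := h'
  exact mk_eq_mk_iff.2 (h1.iso h2 h3.symm h4.symm)

theorem HasShapes.shapes_unique (h : Q.HasShapes S T) (h' : Q.HasShapes S' T') :
    S = S' ∧ T = T' := by
  obtain ⟨G, s, t, rfl, h1, rfl, rfl⟩ := h
  obtain ⟨s', t', h2, rfl, rfl⟩ := h'.of_mk_eq rfl
  rw [h1.cop.unique InPort.cop_injective h2.cop, h1.prod.unique OutPort.prod_injective h2.prod]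
  exact ⟨rfl, rfl⟩

theorem exists_hasShapes (hn : 1 ≤ n) (hS : S.numNodes = n) (hT : T.numNodes = n) :
    ∃ Q : PCPrograph n, Q.HasShapes S T := by
  obtain ⟨s, rfl, hs⟩ := exists_shape_eq_labels_eq S (List.finRange n) (by simp [hS])
  obtain ⟨t, rfl, ht⟩ := exists_shape_eq_labels_eq T (List.finRange n) (by simp [hT])
  obtain ⟨G, hG⟩ := LabelledPrograph.exists_of_labels rfl (s := s) (t := t)
    (hs ▸ List.nodup_finRange n) (fun c => hs ▸ List.mem_finRange c)
    (ht ▸ List.nodup_finRange n) (fun c => ht ▸ List.mem_finRange c) (by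
      rintro rfl
      have h0 : n = 0 := hT.symm
      omega)
  exact ⟨mk G, G, s, t, rfl, hG, rfl, rfl⟩

/-- A rotation of prographs is a rotation in one of the two trees. -/
theorem Rotation.cases (h : Q.Rotation R) (hQ : Q.HasShapes S T) (hR : R.HasShapes S' T') :
    (RightRotation S S' ∧ T = T') ∨ (S = S' ∧ RightRotation T T') := by
  obtain ⟨G, H, hG, hH, hr⟩ := h
  obtain ⟨s, t, h1, rfl, rfl⟩ := hQ.of_mk_eq hG
  rcases hr with hr | hr
  · obtain ⟨s', h2, h3⟩ := h1.exists_of_copRotation hr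
    obtain ⟨rfl, rfl⟩ := hR.shapes_unique ⟨H, s', t, hH, h3, rfl, rfl⟩
    exact Or.inl ⟨h2, rfl⟩
  · obtain ⟨t', h2, h3⟩ := h1.exists_of_prodRotation hr
    obtain ⟨rfl, rfl⟩ := hR.shapes_unique ⟨H, s, t', hH, h3, rfl, rfl⟩
    exact Or.inr ⟨rfl, h2⟩

/-- A representative of `Q` is rotated, and the outcome represents `R` because the two shapes
determine the class. -/
theorem rotation_of_left (hQ : Q.HasShapes S T) (hR : R.HasShapes S' T)
    (h : RightRotation S S') : Q.Rotation R := by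
  obtain ⟨G, s, t, rfl, h1, rfl, rfl⟩ := hQ
  have ht : t ≠ .nil := by
    obtain ⟨a, b, hab⟩ := h1.prod.eq_node rfl OutPort.prod_injective
    simp [hab]
  obtain ⟨H, s', rfl, h2, h3⟩ := h1.exists_copRotation h fun s' _ hs hs' =>
    LabelledPrograph.exists_of_labels rfl hs hs' h1.prod_nodup h1.prod_mem ht
  exact ⟨G, H, rfl, HasShapes.unique ⟨H, s', t, rfl, h2, rfl, rfl⟩ hR, Or.inl h3⟩

theorem rotation_of_right (hQ : Q.HasShapes S T) (hR : R.HasShapes S T')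
    (h : RightRotation T T') : Q.Rotation R := by
  obtain ⟨G, s, t, rfl, h1, rfl, rfl⟩ := hQ
  obtain ⟨H, t', rfl, h2, h3⟩ := h1.exists_prodRotation h fun t' ht'' ht ht' =>
    LabelledPrograph.exists_of_labels rfl h1.cop_nodup h1.cop_mem ht ht' (by
      rintro rfl
      have hnil : t.numNodes = 0 := by
        rw [← numNodes_shape, h.numNodes_eq, ← ht'']
        rfl
      rw [h1.numNodes_prod, Nat.card_fin] at hnil
      exact (hnil ▸ G.north).elim0)
  exact ⟨G, H, rfl, HasShapes.unique ⟨H, s, t', rfl, h2, rfl, rfl⟩ hR, Or.inr h3⟩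

end PCPrograph

/-! ### The order isomorphism with pairs of trees -/

namespace AvoidingPrograph

variable {n : ℕ}

/-- The two trees of an avoiding prograph, the tree of coproducts being turned by half a turn. -/
noncomputable def shapes (Q : AvoidingPrograph n) : Tamari n × Tamari n :=
  (⟨Q.2.exists_hasShapes.choose, Q.2.exists_hasShapes.choose_spec.choose_spec.numNodes_eq.1⟩,
    ⟨Q.2.exists_hasShapes.choose_spec.choose,
      Q.2.exists_hasShapes.choose_spec.choose_spec.numNodes_eq.2⟩)

theorem hasShapes_shapes (Q : AvoidingPrograph n) :
    Q.1.HasShapes Q.shapes.1.1 Q.shapes.2.1 :=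
  Q.2.exists_hasShapes.choose_spec.choose_spec

theorem shapes_bijective (hn : 1 ≤ n) :
    Function.Bijective (shapes : AvoidingPrograph n → Tamari n × Tamari n) := by
  refine ⟨fun Q R h => Subtype.ext (Q.hasShapes_shapes.unique ?_), fun x => ?_⟩
  · rw [h]
    exact R.hasShapes_shapes
  · obtain ⟨Q, hQ⟩ := PCPrograph.exists_hasShapes hn x.1.2 x.2.2
    refine ⟨⟨Q, hQ.avoidsProdCop⟩, ?_⟩
    obtain ⟨h1, h2⟩ := (hasShapes_shapes ⟨Q, hQ.avoidsProdCop⟩).shapes_unique hQ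
    exact Prod.ext (Subtype.ext h1) (Subtype.ext h2)

/-- The bijection between avoiding prographs and pairs of trees. -/
noncomputable def shapesEquiv (hn : 1 ≤ n) : AvoidingPrograph n ≃ Tamari n × Tamari n :=
  Equiv.ofBijective shapes (shapes_bijective hn)

theorem hasShapes_shapesEquiv_symm (hn : 1 ≤ n) (x : Tamari n × Tamari n) :
    ((shapesEquiv hn).symm x).1.HasShapes x.1.1 x.2.1 := by
  have h := hasShapes_shapes ((shapesEquiv hn).symm x)
  have e : ((shapesEquiv hn).symm x).shapes = x := (shapesEquiv hn).apply_symm_apply x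
  rwa [e] at h

theorem Reaches.shapes_le {Q R : AvoidingPrograph n} (h : Q.Reaches R) : Q.shapes ≤ R.shapes := by
  induction h with
  | refl => exact ⟨ReflTransGen.refl, ReflTransGen.refl⟩
  | @tail R R' _ hr ih =>
    rcases hr.cases R.hasShapes_shapes R'.hasShapes_shapes with ⟨h1, h2⟩ | ⟨h1, h2⟩
    · exact ⟨ReflTransGen.tail ih.1 h1, (Subtype.ext h2 : R.shapes.2 = R'.shapes.2) ▸ ih.2⟩
    · exact ⟨(Subtype.ext h1 : R.shapes.1 = R'.shapes.1) ▸ ih.1, ReflTransGen.tail ih.2 h2⟩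

theorem reaches_left (hn : 1 ≤ n) {S S' : Tamari n} (T : Tamari n) (h : S.Reaches S') :
    ((shapesEquiv hn).symm (S, T)).Reaches ((shapesEquiv hn).symm (S', T)) := by
  obtain ⟨S, hS⟩ := S
  obtain ⟨S', hS'⟩ := S'
  replace h : ReflTransGen RightRotation S S' := h
  induction h with
  | refl => exact ReflTransGen.refl
  | tail _ hr ih =>
    have hS'' := hr.numNodes_eq.trans hS'
    exact ReflTransGen.tail (ih hS'') (PCPrograph.rotation_of_left
      (hasShapes_shapesEquiv_symm hn _) (hasShapes_shapesEquiv_symm hn _) hr)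

theorem reaches_right (hn : 1 ≤ n) (S : Tamari n) {T T' : Tamari n} (h : T.Reaches T') :
    ((shapesEquiv hn).symm (S, T)).Reaches ((shapesEquiv hn).symm (S, T')) := by
  obtain ⟨T, hT⟩ := T
  obtain ⟨T', hT'⟩ := T'
  replace h : ReflTransGen RightRotation T T' := h
  induction h with
  | refl => exact ReflTransGen.refl
  | tail _ hr ih =>
    have hT'' := hr.numNodes_eq.trans hT'
    exact ReflTransGen.tail (ih hT'') (PCPrograph.rotation_of_right
      (hasShapes_shapesEquiv_symm hn _) (hasShapes_shapesEquiv_symm hn _) hr)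

/-- For the converse of `Reaches.shapes_le`, all rotations of the coproduct tree are carried out
first with the product tree fixed, then those of the product tree. -/
theorem shapes_le_iff (hn : 1 ≤ n) (Q R : AvoidingPrograph n) :
    Q.shapes ≤ R.shapes ↔ Q.Reaches R := by
  refine ⟨fun h => ?_, Reaches.shapes_le⟩
  have h1 := (reaches_left hn Q.shapes.2 h.1).trans (reaches_right hn R.shapes.1 h.2)
  have e : ∀ Q : AvoidingPrograph n, (shapesEquiv hn).symm (Q.shapes.1, Q.shapes.2) = Q :=
    fun Q => (shapesEquiv hn).symm_apply_apply Q
  rwa [e, e] at h1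

/-- Avoiding prographs, ordered by rotations, are pairs of trees in the Tamari order. -/
noncomputable def shapesOrderIso (hn : 1 ≤ n) : AvoidingPrograph n ≃o Tamari n × Tamari n where
  toEquiv := shapesEquiv hn
  map_rel_iff' {Q R} := shapes_le_iff hn Q R

theorem exists_lattice (hn : 1 ≤ n) :
    ∃ L : Lattice (AvoidingPrograph n), ∀ Q R : AvoidingPrograph n, L.le Q R ↔ Q.Reaches R := by
  obtain ⟨L, hL⟩ := Tamari.exists_lattice n
  refine exists_lattice_of_equiv (shapesEquiv hn) fun Q R => ?_
  rw [← shapes_le_iff hn]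
  exact and_congr (hL _ _) (hL _ _)

end AvoidingPrograph

theorem theorem3 (n : ℕ) (hn : 1 ≤ n) :
    (∀ Q : PCPrograph n,
      Q.AvoidsProdCop ↔ ∃ S T : BinaryTree Unit, Q.IsGluing S T) ∧
    (∃ L : Lattice (Tamari n), ∀ S T : Tamari n, L.le S T ↔ S.Reaches T) ∧
    (∃ L : Lattice (AvoidingPrograph n), ∀ Q R : AvoidingPrograph n, L.le Q R ↔ Q.Reaches R) ∧
    ∃ e : AvoidingPrograph n ≃o Tamari n × Tamari n,
      ∀ Q : AvoidingPrograph n, Q.1.IsGluing (mirror (e Q).1.1) (e Q).2.1 := by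
  refine ⟨fun Q => ⟨fun h => ?_, ?_⟩, Tamari.exists_lattice n, AvoidingPrograph.exists_lattice hn,
    AvoidingPrograph.shapesOrderIso hn, fun Q => ?_⟩
  · obtain ⟨S, T, hST⟩ := h.exists_hasShapes
    refine ⟨mirror S, T, PCPrograph.isGluing_iff_hasShapes.2 ?_⟩
    rwa [mirror_mirror]
  · rintro ⟨S, T, h⟩
    exact (PCPrograph.isGluing_iff_hasShapes.1 h).avoidsProdCop
  · refine PCPrograph.isGluing_iff_hasShapes.2 ?_
    rw [mirror_mirror]
    exact Q.hasShapes_shapes
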